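/- For a finite group $G$, the prime graph $\Gamma(G)$ has as vertices the prime divisors of $|G|$, and two distinct primes $p,q$ are adjacent iff $G$ has an element of order $pq$. A group $G$ is almost simple related to $S$ if $S$ is a nonabelian simple group and, up to isomorphism, $\mathrm{Inn}(S)\le G\le \mathrm{Aut}(S)$. For a prime $p$ let $U_n(p)=\mathrm{PSU}_n(p)=\mathrm{SU}_n(p)/Z(\mathrm{SU}_n(p))$, where $\mathrm{SU}_n(p)$ and $\mathrm{GU}_n(p)$ are the special and general unitary groups over $\mathbb F_{p^2}$ of the form $\sum_i x_iy_i^p$. For $D\in \mathrm{GU}_n(p)$ let $\tau_D\in\mathrm{Aut}(U_n(p))$ be induced by $A\mapsto D A^{(p)}D^{-1}$, where $A^{(p)}$ is $A$ with every entry raised to the power $p$. Here $U_n(p)\cdot 2$ denotes any of the subgroups $\langle \mathrm{Inn}(U_n(p)),\tau_D\rangle$ of $\mathrm{Aut}(U_n(p))$, $D\in\mathrm{GU}_n(p)$. (For $U_4(3)$ these are the extensions of degree $2$ in $\mathrm{Aut}(U_4(3))$ not contained in $\mathrm{PGU}_4(3)$, that is, $U_4(3).2_2$ and $U_4(3).2_3$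 in ATLAS notation.) **Lemma.** Each of the following groups $G$ is an almost simple group related to the simple group $S$, and $\Gamma(G)=\Gamma(\mathrm{PGL}(2,49))$: 1. $G=S_7$ and $S=A_7$; 2. $G=U_4(3)\cdot 2$ and $S=U_4(3)$; 3. $G=U_3(5)$ or $G=U_3(5)\cdot 2$, and $S=U_3(5)$. In (2) and (3), $\mathrm{Inn}(S)$ has index $2$ in $S\cdot 2$, for every choice of $D$. The graph $\Gamma(\mathrm{PGL}(2,49))$ has vertex set $\{2,3,5,7\}$ and exactly the edges $2$–$3$ and $2$–$5$. -/

import Mathlib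

open scoped MatrixGroups

/-- The prime graph `Γ(G)` of a (finite) group, as a graph whose vertex set is the set of prime
divisors of `|G|`; distinct primes `p`, `q` are adjacent when `G` has an element of order `p * q`.
It is encoded as a subgraph of the complete graph on `ℕ`, so that equality of prime graphs of
different groups means: same vertices and same edges. -/
def primeGraph (G : Type*) [Group G] : (⊤ : SimpleGraph ℕ).Subgraph where
  verts := {p | p.Prime ∧ p ∣ Nat.card G}
  Adj p q := p.Prime ∧ q.Prime ∧ p ≠ q ∧ ∃ g : G, orderOf g = p * q
  adj_sub := fun h => h.2.2.1
  edge_vert := by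
    rintro p q ⟨hp, -, -, g, hg⟩
    exact ⟨hp, (Dvd.intro q hg.symm).trans (orderOf_dvd_natCard g)⟩
  symm := by
    refine ⟨?_⟩
    rintro p q ⟨hp, hq, hne, g, hg⟩
    exact ⟨hq, hp, hne.symm, g, by rw [hg, mul_comm]⟩

/-- `G` is an almost simple group related to `S`: the group `S` is nonabelian simple and, up to
isomorphism, `Inn S ≤ G ≤ Aut S`. -/
def IsAlmostSimpleOver (G S : Type*) [Group G] [Group S] : Prop :=
  IsSimpleGroup S ∧ (¬ ∀ a b : S, a * b = b * a) ∧
    ∃ f : G →* MulAut S, Function.Injective f ∧ (MulAut.conj : S →* MulAut S).range ≤ f.range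

/-- The field `𝔽_{p²}` with the involution `x ↦ x ^ p`. -/
noncomputable instance galoisStarRing (p : ℕ) [Fact p.Prime] : StarRing (GaloisField p 2) where
  star x := x ^ p
  star_involutive x := by
    have h : x ^ Nat.card (GaloisField p 2) = x := by
      have := Fintype.ofFinite (GaloisField p 2)
      rw [Nat.card_eq_fintype_card]
      exact FiniteField.pow_card x
    rw [GaloisField.card p 2 two_ne_zero] at h
    change (x ^ p) ^ p = x
    rw [← pow_mul, ← sq, h]
  star_mul x y := by
    change (x * y) ^ p = y ^ p * x ^ p
    rw [mul_pow, mul_comm]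
  star_add x y := by
    have : CharP (GaloisField p 2) p := inferInstance
    exact add_pow_char x y p

/-- `GU_n(p)`: the unitary group of the Hermitian form `∑ x_i y_i^p` on `(𝔽_{p²})^n`. -/
abbrev GU (n p : ℕ) [Fact p.Prime] : Type :=
  Matrix.unitaryGroup (Fin n) (GaloisField p 2)

/-- `SU_n(p)`. -/
abbrev SU (n p : ℕ) [Fact p.Prime] : Type :=
  Matrix.specialUnitaryGroup (Fin n) (GaloisField p 2)

/-- `U_n(p) = PSU_n(p)`. -/
abbrev PSU (n p : ℕ) [Fact p.Prime] : Type :=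
  SU n p ⧸ Subgroup.center (SU n p)

/-- The automorphism `A ↦ D * A * D⁻¹` of `SU_n(p)`, for `D` in `GU_n(p)`. -/
noncomputable def conjSU (n p : ℕ) [Fact p.Prime] (D : GU n p) : MulAut (SU n p) where
  toFun A := ⟨D.1 * A.1 * (D⁻¹).1, by
    have hA := Matrix.mem_specialUnitaryGroup_iff.1 A.2
    refine Matrix.mem_specialUnitaryGroup_iff.2 ⟨mul_mem (mul_mem D.2 hA.1) (D⁻¹).2, ?_⟩
    rw [Matrix.det_mul_right_comm, ← Submonoid.coe_mul, mul_inv_cancel, Submonoid.coe_one,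
      one_mul, hA.2]⟩
  invFun A := ⟨(D⁻¹).1 * A.1 * D.1, by
    have hA := Matrix.mem_specialUnitaryGroup_iff.1 A.2
    refine Matrix.mem_specialUnitaryGroup_iff.2 ⟨mul_mem (mul_mem (D⁻¹).2 hA.1) D.2, ?_⟩
    rw [Matrix.det_mul_right_comm, ← Submonoid.coe_mul, inv_mul_cancel, Submonoid.coe_one,
      one_mul, hA.2]⟩
  left_inv A := by
    have h : (D⁻¹).1 * D.1 = 1 := by rw [← Submonoid.coe_mul, inv_mul_cancel, Submonoid.coe_one]
    apply Subtype.ext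
    change (D⁻¹).1 * (D.1 * A.1 * (D⁻¹).1) * D.1 = A.1
    rw [mul_assoc D.1, ← mul_assoc, h, one_mul, mul_assoc, h, mul_one]
  right_inv A := by
    have h : D.1 * (D⁻¹).1 = 1 := by rw [← Submonoid.coe_mul, mul_inv_cancel, Submonoid.coe_one]
    apply Subtype.ext
    change D.1 * ((D⁻¹).1 * A.1 * D.1) * (D⁻¹).1 = A.1
    rw [mul_assoc (D⁻¹).1, ← mul_assoc, h, one_mul, mul_assoc, h, mul_one]
  map_mul' A B := by
    have h : (D⁻¹).1 * D.1 = 1 := by rw [← Submonoid.coe_mul, inv_mul_cancel, Submonoid.coe_one]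
    apply Subtype.ext
    change D.1 * (A.1 * B.1) * (D⁻¹).1 = D.1 * A.1 * (D⁻¹).1 * (D.1 * B.1 * (D⁻¹).1)
    simp only [mul_assoc]
    rw [← mul_assoc (D⁻¹).1 D.1, h, one_mul]

theorem map_star_mem_SU (n p : ℕ) [Fact p.Prime] (A : SU n p) :
    A.1.map (starRingEnd (GaloisField p 2)) ∈
      Matrix.specialUnitaryGroup (Fin n) (GaloisField p 2) := by
  have hA := Matrix.mem_specialUnitaryGroup_iff.1 A.2
  refine Matrix.mem_specialUnitaryGroup_iff.2 ⟨?_, ?_⟩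
  · rw [Matrix.mem_unitaryGroup_iff]
    have h1 := Matrix.mem_unitaryGroup_iff.1 hA.1
    have h2 : star (A.1.map (starRingEnd (GaloisField p 2))) =
        (star A.1).map (starRingEnd (GaloisField p 2)) := by
      ext i j
      simp [Matrix.star_apply, starRingEnd_apply]
    rw [h2, ← Matrix.map_mul, h1]
    simp
  · rw [← RingHom.mapMatrix_apply, ← RingHom.map_det, hA.2, map_one]

/-- The field automorphism of `SU_n(p)`: raise every matrix entry to the power `p`. -/
noncomputable def frobSU (n p : ℕ) [Fact p.Prime] : MulAut (SU n p) where
  toFun A := ⟨A.1.map (starRingEnd (GaloisField p 2)), map_star_mem_SU n p A⟩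
  invFun A := ⟨A.1.map (starRingEnd (GaloisField p 2)), map_star_mem_SU n p A⟩
  left_inv A := by
    apply Subtype.ext
    ext i j
    simp
  right_inv A := by
    apply Subtype.ext
    ext i j
    simp
  map_mul' A B := Subtype.ext (Matrix.map_mul (f := starRingEnd (GaloisField p 2)))

/-- The automorphism of `U_n(p)` induced by `A ↦ D * A^(p) * D⁻¹`, where `A^(p)` is obtained from
`A` by raising every entry to the power `p`. -/
noncomputable def semilinearAut (n p : ℕ) [Fact p.Prime] (D : GU n p) : MulAut (PSU n p) :=
  QuotientGroup.congr _ _ (conjSU n p D * frobSU n p)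
    (Subgroup.characteristic_iff_map_eq.1 inferInstance _)

/-- An extension `U_n(p)·2`: the subgroup of `Aut (U_n(p))` generated by the inner automorphisms
and the automorphism induced by `A ↦ D * A^(p) * D⁻¹`. -/
noncomputable def PSUDotTwo (n p : ℕ) [Fact p.Prime] (D : GU n p) : Subgroup (MulAut (PSU n p)) :=
  (MulAut.conj : PSU n p →* MulAut (PSU n p)).range ⊔ Subgroup.zpowers (semilinearAut n p D)

instance fact_prime_five : Fact (Nat.Prime 5) := ⟨by norm_num⟩

instance fact_prime_seven : Fact (Nat.Prime 7) := ⟨by norm_num⟩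

/-- `PGL(2, 49)`. -/
abbrev PGL2F49 : Type := PGL(2, GaloisField 7 2)

/-! Every group in the statement is shown to have the same prime graph: the path 3–2–5 plus the
isolated vertex 7 (`HasPathPrimeGraph`). This needs a restriction on element orders and elements of
orders 6, 7 and 10.

Simplicity of the unitary groups is Iwasawa's argument. The Siegel unipotents `siegelSU` act
transitively on hyperbolic pairs and contain the stabilizer of one such pair, so they generate SU.
They are also commutators, so SU is perfect. Those attached to one isotropic vector form a group of
nilpotency class at most two. A normal subgroup moving some isotropic line is transitive on
isotropic lines, so this nilpotent group covers the quotient, which is perfect and hence trivial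
(`normal_eq_top`).

Element orders come from Cayley–Hamilton. The characteristic polynomial of a special unitary matrix
is conjugate-reciprocal, so for U_3(5) it depends on one element of F_25, and for U_4(3) on one
element of F_9 and one of F_3. Reducing X^k modulo it shows which powers are scalar, and the few
cases are enumerated in a computable model of the field.

An element of U_n(p)·2 outside the inner automorphisms is some τ_E, and its square is inner. A
square of order 7 would be fixed by τ_E. This is impossible: up to a scalar, an element of order 7
has nontrivial eigenvalues ζ, ζ², ζ⁴, and since p = 3, 5 are nonresidues modulo 7, the p-power map
sends these to their inverses. So the outer coset creates no new edge at 7. The group U_3(5) already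
has elements of order 10. U_4(3) has none, and in U_4(3)·2 one is built as an element of order 5
times a commuting semilinear involution, for each possible determinant of D.

PGL(2,49) is handled by scaling matrices to trace one, and S_7 by cycle types. -/

set_option linter.unusedSectionVars false

/-! ### Hermitian forms and Siegel unipotents. -/

section HermitianForm

open Matrix

variable {K : Type*} [Field K] [StarRing K] {ι : Type*} [Fintype ι]

/-- The Hermitian form `∑ xᵢ ȳᵢ`. -/
def hform (x y : ι → K) : K := x ⬝ᵥ star y

@[simp] theorem hform_add_left (x y z : ι → K) : hform (x + y) z = hform x z + hform y z :=
  add_dotProduct _ _ _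

@[simp] theorem hform_sub_left (x y z : ι → K) : hform (x - y) z = hform x z - hform y z :=
  sub_dotProduct _ _ _

@[simp] theorem hform_smul_left (c : K) (x y : ι → K) : hform (c • x) y = c * hform x y :=
  smul_dotProduct _ _ _

@[simp] theorem hform_neg_left (x y : ι → K) : hform (-x) y = -hform x y :=
  neg_dotProduct _ _

@[simp] theorem hform_zero_left (y : ι → K) : hform 0 y = 0 := zero_dotProduct _

@[simp] theorem hform_add_right (x y z : ι → K) : hform x (y + z) = hform x y + hform x z := by
  simp [hform]

@[simp] theorem hform_sub_right (x y z : ι → K) : hform x (y - z) = hform x y - hform x z := by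
  simp [hform]

@[simp] theorem hform_smul_right (c : K) (x y : ι → K) :
    hform x (c • y) = star c * hform x y := by
  simp [hform]

@[simp] theorem hform_neg_right (x y : ι → K) : hform x (-y) = -hform x y := by
  simp [hform]

@[simp] theorem hform_zero_right (x : ι → K) : hform x 0 = 0 := by simp [hform]

@[simp] theorem star_hform (x y : ι → K) : star (hform x y) = hform y x := by
  simp only [hform, dotProduct, star_sum, Pi.star_apply, StarMul.star_mul, star_star]

theorem hform_eq_zero_symm {x y : ι → K} (h : hform x y = 0) : hform y x = 0 := by
  rw [← star_hform, h, star_zero]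

variable [DecidableEq ι]

theorem hform_single_right (x : ι → K) (i : ι) : hform x (Pi.single i 1) = x i := by
  rw [hform, show star (Pi.single i 1 : ι → K) = Pi.single i 1 by rw [← Pi.single_star, star_one]]
  simp

theorem hform_nondegenerate {x : ι → K} (h : ∀ y, hform x y = 0) : x = 0 := by
  ext i
  simpa [hform_single_right] using h (Pi.single i 1)

theorem exists_hform_eq_one {x : ι → K} (h : x ≠ 0) : ∃ y, hform y x = 1 := by
  have : ∃ y, hform x y ≠ 0 := by
    by_contra! h'
    exact h (hform_nondegenerate h')
  obtain ⟨y, hy⟩ := this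
  refine ⟨(hform y x)⁻¹ • y, ?_⟩
  rw [hform_smul_left, inv_mul_cancel₀]
  exact fun h => hy (hform_eq_zero_symm h)

theorem hform_mulVec_left (A : Matrix ι ι K) (x y : ι → K) :
    hform (A *ᵥ x) y = hform x (star A *ᵥ y) := by
  rw [hform, hform, star_mulVec, star_eq_conjTranspose, conjTranspose_conjTranspose,
    dotProduct_comm, dotProduct_mulVec, dotProduct_comm]

theorem mem_unitaryGroup_of_hform {A : Matrix ι ι K}
    (h : ∀ x y, hform (A *ᵥ x) (A *ᵥ y) = hform x y) : A ∈ unitaryGroup ι K := by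
  rw [mem_unitaryGroup_iff']
  refine mulVec_injective (funext fun y => ?_)
  rw [one_mulVec, ← sub_eq_zero]
  refine hform_nondegenerate fun x => hform_eq_zero_symm ?_
  rw [hform_sub_right, ← mulVec_mulVec, ← hform_mulVec_left, h, sub_self]

theorem hform_mulVec_mulVec {A : Matrix ι ι K} (hA : A ∈ unitaryGroup ι K) (x y : ι → K) :
    hform (A *ᵥ x) (A *ᵥ y) = hform x y := by
  rw [hform_mulVec_left, mulVec_mulVec, mem_unitaryGroup_iff'.1 hA, one_mulVec]

/-- The perturbation factors through a plane, so det(1 + UV) = det(1 + VU) reduces the computation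
to a 2×2 determinant. -/
theorem det_one_add_vecMulVec_add_vecMulVec (x₁ x₂ y₁ y₂ : ι → K) :
    (1 + vecMulVec x₁ y₁ + vecMulVec x₂ y₂).det =
      (1 + y₁ ⬝ᵥ x₁) * (1 + y₂ ⬝ᵥ x₂) - (y₁ ⬝ᵥ x₂) * (y₂ ⬝ᵥ x₁) := by
  have h : vecMulVec x₁ y₁ + vecMulVec x₂ y₂ = (of ![x₁, x₂])ᵀ * of ![y₁, y₂] := by
    ext i j
    simp [vecMulVec_apply, Matrix.mul_apply, Fin.sum_univ_two]
  rw [add_assoc, h, det_one_add_mul_comm, det_fin_two]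
  simp only [Matrix.add_apply, Matrix.mul_apply]
  simp [dotProduct]

/-- The unipotent matrix `1 + m v* - v m* + c v v*`. -/
def siegel (v m : ι → K) (c : K) : Matrix ι ι K :=
  1 + vecMulVec m (star v) + vecMulVec v (star (star c • v - m))

theorem siegel_mulVec (v m : ι → K) (c : K) (x : ι → K) :
    siegel v m c *ᵥ x = x + hform x v • m + (c * hform x v - hform x m) • v := by
  have h (y : ι → K) : star y ⬝ᵥ x = hform x y := dotProduct_comm _ _
  rw [siegel, add_mulVec, add_mulVec, vecMulVec_mulVec, vecMulVec_mulVec, one_mulVec, h, h,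
    op_smul_eq_smul, op_smul_eq_smul]
  simp

/-- The conditions under which `siegel v m c` is unitary. -/
structure SiegelDatum (v m : ι → K) (c : K) : Prop where
  isotropic : hform v v = 0
  perp : hform m v = 0
  trace : c + star c = -hform m m

theorem SiegelDatum.perp' {v m : ι → K} {c : K} (h : SiegelDatum v m c) : hform v m = 0 :=
  hform_eq_zero_symm h.perp

theorem siegel_mem {v m : ι → K} {c : K} (h : SiegelDatum v m c) :
    siegel v m c ∈ specialUnitaryGroup ι K := by
  refine mem_specialUnitaryGroup_iff.2 ⟨mem_unitaryGroup_of_hform fun x y => ?_, ?_⟩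
  · simp only [siegel_mulVec, hform_add_left, hform_add_right, hform_smul_left, hform_smul_right,
      star_sub, StarMul.star_mul, star_hform, h.isotropic, h.perp, h.perp']
    linear_combination (hform x v * hform v y) * h.trace
  · have e (y z : ι → K) : star y ⬝ᵥ z = hform z y := dotProduct_comm _ _
    rw [siegel, det_one_add_vecMulVec_add_vecMulVec]
    simp [e, h.isotropic, h.perp, h.perp']

/-- `siegel v m c` as an element of the special unitary group. -/
def siegelSU {v m : ι → K} {c : K} (h : SiegelDatum v m c) : specialUnitaryGroup ι K :=
  ⟨siegel v m c, siegel_mem h⟩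

theorem siegelSU_mulVec {v m : ι → K} {c : K} (h : SiegelDatum v m c) (x : ι → K) :
    (siegelSU h).1 *ᵥ x = x + hform x v • m + (c * hform x v - hform x m) • v :=
  siegel_mulVec v m c x

theorem SU_ext {A B : specialUnitaryGroup ι K} (h : ∀ x, A.1 *ᵥ x = B.1 *ᵥ x) : A = B :=
  Subtype.ext (mulVec_injective (funext h))

theorem SU_mul_mulVec (A B : specialUnitaryGroup ι K) (x : ι → K) :
    (A * B).1 *ᵥ x = A.1 *ᵥ (B.1 *ᵥ x) :=
  (mulVec_mulVec _ _ _).symm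

theorem SU_one_mulVec (x : ι → K) : (1 : specialUnitaryGroup ι K).1 *ᵥ x = x :=
  one_mulVec _

theorem SU_inv_mulVec_eq {A : specialUnitaryGroup ι K} {x y : ι → K} :
    (A⁻¹).1 *ᵥ x = y ↔ x = A.1 *ᵥ y := by
  constructor
  · rintro rfl
    rw [← SU_mul_mulVec, mul_inv_cancel, SU_one_mulVec]
  · rintro rfl
    rw [← SU_mul_mulVec, inv_mul_cancel, SU_one_mulVec]

@[simp] theorem SU_hform (A : specialUnitaryGroup ι K) (x y : ι → K) :
    hform (A.1 *ᵥ x) (A.1 *ᵥ y) = hform x y :=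
  hform_mulVec_mulVec A.2.1 x y

theorem SU_mulVec_ne_zero (A : specialUnitaryGroup ι K) {x : ι → K} (hx : x ≠ 0) :
    A.1 *ᵥ x ≠ 0 := fun h => hx <| by
  rw [← SU_one_mulVec x, ← inv_mul_cancel A, SU_mul_mulVec, h, mulVec_zero]

theorem SiegelDatum.map {v m : ι → K} {c : K} (h : SiegelDatum v m c)
    (A : specialUnitaryGroup ι K) : SiegelDatum (A.1 *ᵥ v) (A.1 *ᵥ m) c :=
  ⟨by simpa using h.isotropic, by simpa using h.perp, by simpa using h.trace⟩

theorem conj_siegelSU {v m : ι → K} {c : K} (h : SiegelDatum v m c)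
    (A : specialUnitaryGroup ι K) : A * siegelSU h * A⁻¹ = siegelSU (h.map A) := by
  refine SU_ext fun x => ?_
  obtain ⟨y, rfl⟩ : ∃ y, x = A.1 *ᵥ y := ⟨_, SU_inv_mulVec_eq.1 rfl⟩
  rw [← SU_mul_mulVec, inv_mul_cancel_right, SU_mul_mulVec, siegelSU_mulVec, siegelSU_mulVec]
  simp [mulVec_add, mulVec_smul]

theorem SiegelDatum.add {v m₁ m₂ : ι → K} {c₁ c₂ : K} (h₁ : SiegelDatum v m₁ c₁)
    (h₂ : SiegelDatum v m₂ c₂) : SiegelDatum v (m₁ + m₂) (c₁ + c₂ - hform m₂ m₁) :=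
  ⟨h₁.isotropic, by simp [h₁.perp, h₂.perp], by
    simp only [star_sub, star_add, star_hform, hform_add_left, hform_add_right]
    linear_combination h₁.trace + h₂.trace⟩

/-- For fixed v this is a Heisenberg-type group law; the asymmetric term `hform m₂ m₁` produces all
its commutators. -/
theorem siegelSU_mul {v m₁ m₂ : ι → K} {c₁ c₂ : K} (h₁ : SiegelDatum v m₁ c₁)
    (h₂ : SiegelDatum v m₂ c₂) : siegelSU h₁ * siegelSU h₂ = siegelSU (h₁.add h₂) := by
  refine SU_ext fun x => ?_
  simp only [SU_mul_mulVec, siegelSU_mulVec, hform_add_left, hform_add_right, hform_smul_left,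
    h₁.isotropic, h₁.perp', h₂.perp]
  module

theorem SiegelDatum.zero {v : ι → K} (h : hform v v = 0) : SiegelDatum v 0 0 :=
  ⟨h, by simp, by simp⟩

theorem siegelSU_zero {v : ι → K} (h : hform v v = 0) : siegelSU (SiegelDatum.zero h) = 1 :=
  SU_ext fun x => by simp [siegelSU_mulVec]

theorem siegelSU_congr {v m m' : ι → K} {c c' : K} (h : SiegelDatum v m c)
    (h' : SiegelDatum v m' c') (hm : m = m') (hc : c = c') : siegelSU h = siegelSU h' := by
  subst hm hc
  rfl

theorem SiegelDatum.inv {v m : ι → K} {c : K} (h : SiegelDatum v m c) :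
    SiegelDatum v (-m) (star c) :=
  ⟨h.isotropic, by simp [h.perp], by
    rw [star_star, hform_neg_left, hform_neg_right, neg_neg, add_comm, h.trace]⟩

theorem siegelSU_inv {v m : ι → K} {c : K} (h : SiegelDatum v m c) :
    (siegelSU h)⁻¹ = siegelSU h.inv := by
  rw [inv_eq_iff_mul_eq_one, siegelSU_mul, ← siegelSU_zero h.isotropic]
  refine siegelSU_congr _ _ (by simp) ?_
  rw [hform_neg_left, h.trace]
  ring

end HermitianForm

/-! ### Isotropic vectors. -/

section SpecialUnitary

open Matrix

/-- A field of characteristic not two with a nontrivial involution whose norm map is surjective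
onto the fixed field. -/
structure HasSurjectiveNorm (K : Type*) [Field K] [StarRing K] : Prop where
  two_ne : (2 : K) ≠ 0
  exists_skew : ∃ θ : K, θ ≠ 0 ∧ star θ = -θ
  exists_norm : ∀ k : K, star k = k → ∃ x, x * star x = k

variable {K : Type*} [Field K] [StarRing K] {ι : Type*} [Fintype ι] [DecidableEq ι]

/-- A nonzero isotropic vector. -/
structure IsIsotropic (v : ι → K) : Prop where
  ne_zero : v ≠ 0
  hform_self : hform v v = 0

theorem ne_zero_of_hform_ne_zero {x y : ι → K} (h : hform x y ≠ 0) : x ≠ 0 := by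
  rintro rfl
  simp at h

theorem IsIsotropic.map {v : ι → K} (hv : IsIsotropic v) (A : specialUnitaryGroup ι K) :
    IsIsotropic (A.1 *ᵥ v) :=
  ⟨SU_mulVec_ne_zero A hv.ne_zero, by simpa using hv.hform_self⟩

theorem IsIsotropic.smul {v : ι → K} (hv : IsIsotropic v) {c : K} (hc : c ≠ 0) :
    IsIsotropic (c • v) :=
  ⟨smul_ne_zero hc hv.ne_zero, by simp [hv.hform_self]⟩

namespace HasSurjectiveNorm

theorem exists_add_star (hK : HasSurjectiveNorm K) (k : K) (hk : star k = k) : ∃ c : K, c + star c = k := by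
  refine ⟨k / 2, ?_⟩
  have := hK.two_ne
  rw [star_div₀, hk, star_ofNat]
  field_simp
  ring

/-- The norm of y + sv is h(y,y) plus the trace of s·h(v,y), and this trace can be prescribed. -/
theorem exists_isotropic_add_smul (hK : HasSurjectiveNorm K) {y v : ι → K} (hv : hform v v = 0) (h : hform y v ≠ 0) :
    ∃ s : K, IsIsotropic (y + s • v) := by
  obtain ⟨c, hc⟩ := hK.exists_add_star (-hform y y) (by simp)
  have h' : hform v y ≠ 0 := fun h0 => h (hform_eq_zero_symm h0)
  refine ⟨c / hform v y, ne_zero_of_hform_ne_zero (y := v) (by simpa [hv] using h), ?_⟩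
  simp only [hform_add_left, hform_add_right, hform_smul_left, hform_smul_right, hv, star_div₀,
    star_hform]
  field_simp
  linear_combination (hform v y * hform y v) * hc

theorem exists_isotropic_hform_eq_one (hK : HasSurjectiveNorm K) {v : ι → K} (hv : IsIsotropic v) :
    ∃ f, IsIsotropic f ∧ hform v f = 1 := by
  obtain ⟨y, hy⟩ := exists_hform_eq_one hv.ne_zero
  obtain ⟨s, hs⟩ := hK.exists_isotropic_add_smul hv.hform_self (y := y) (by simp [hy])
  refine ⟨_, hs, ?_⟩
  rw [← star_hform]
  simp [hy, hv.hform_self]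

/-- The norm of v + sw is the trace of s·h(w,v), which vanishes once that product is skew. -/
theorem exists_isotropic_combination (hK : HasSurjectiveNorm K) {v w : ι → K} (hv : IsIsotropic v) (hw : IsIsotropic w)
    (h : hform v w ≠ 0) : ∃ s : K, s ≠ 0 ∧ IsIsotropic (v + s • w) := by
  obtain ⟨θ, hθ, hs⟩ := hK.exists_skew
  have h' : hform w v ≠ 0 := fun h0 => h (hform_eq_zero_symm h0)
  refine ⟨θ / hform w v, div_ne_zero hθ h',
    ne_zero_of_hform_ne_zero (y := w) (by simpa [hw.hform_self] using h), ?_⟩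
  simp only [hform_add_left, hform_add_right, hform_smul_left, hform_smul_right, hv.hform_self,
    hw.hform_self, star_div₀, star_hform, hs]
  field_simp
  ring

theorem exists_isotropic_not_perp (hK : HasSurjectiveNorm K) {v w : ι → K} (hv : IsIsotropic v) (hw : IsIsotropic w) :
    ∃ z, IsIsotropic z ∧ hform z v ≠ 0 ∧ hform z w ≠ 0 := by
  by_cases h : hform v w = 0
  · obtain ⟨y, hyv, hyw⟩ : ∃ y, hform y v ≠ 0 ∧ hform y w ≠ 0 := by
      obtain ⟨y₁, h₁⟩ := exists_hform_eq_one hv.ne_zero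
      obtain ⟨y₂, h₂⟩ := exists_hform_eq_one hw.ne_zero
      by_cases h₁' : hform y₁ w = 0
      · by_cases h₂' : hform y₂ v = 0
        · exact ⟨y₁ + y₂, by simp [h₁, h₂'], by simp [h₁', h₂]⟩
        · exact ⟨y₂, h₂', by simp [h₂]⟩
      · exact ⟨y₁, by simp [h₁], h₁'⟩
    obtain ⟨s, hs⟩ := hK.exists_isotropic_add_smul hv.hform_self hyv
    exact ⟨_, hs, by simpa [hv.hform_self] using hyv, by simpa [h] using hyw⟩
  · obtain ⟨s, hs0, hs⟩ := hK.exists_isotropic_combination hv hw h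
    refine ⟨_, hs, ?_, by simpa [hw.hform_self] using h⟩
    simpa [hv.hform_self, hs0] using fun h0 => h (hform_eq_zero_symm h0)

/-- A matrix fixing all isotropic lines is scalar. -/
theorem exists_eq_smul_one (hK : HasSurjectiveNorm K) {A : Matrix ι ι K} (hA : ∀ v, IsIsotropic v → ∃ c : K, A *ᵥ v = c • v)
    {v₀ : ι → K} (hv₀ : IsIsotropic v₀) : ∃ c : K, A = c • 1 := by
  -- Non-perpendicular isotropic eigenvectors share their eigenvalue: pairing the eigenvector v + sw
  -- with w and with v isolates a and b.
  have key {v w : ι → K} (hv : IsIsotropic v) (hw : IsIsotropic w) (h : hform v w ≠ 0) {a b : K}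
      (ha : A *ᵥ v = a • v) (hb : A *ᵥ w = b • w) : a = b := by
    obtain ⟨s, hs0, hs⟩ := hK.exists_isotropic_combination hv hw h
    obtain ⟨c, hc⟩ := hA _ hs
    rw [mulVec_add, mulVec_smul, ha, hb] at hc
    have h₁ := congrArg (hform · w) hc
    have h₂ := congrArg (hform · v) hc
    have h' : hform w v ≠ 0 := fun h0 => h (hform_eq_zero_symm h0)
    simp only [hform_add_left, hform_smul_left, hv.hform_self, hw.hform_self] at h₁ h₂
    have e₁ : a = c := mul_right_cancel₀ h (by linear_combination h₁)
    have e₂ : b = c := mul_right_cancel₀ (mul_ne_zero hs0 h') (by linear_combination h₂)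
    rw [e₁, e₂]
  obtain ⟨c, hc⟩ := hA _ hv₀
  have hall {w : ι → K} (hw : IsIsotropic w) : A *ᵥ w = c • w := by
    obtain ⟨z, hz, hzv, hzw⟩ := hK.exists_isotropic_not_perp hv₀ hw
    obtain ⟨a, ha⟩ := hA _ hz
    obtain ⟨b, hb⟩ := hA _ hw
    rw [hb, ← key hz hw hzw ha hb, key hz hv₀ hzv ha hc]
  have hnp {y : ι → K} (hy : hform y v₀ ≠ 0) : A *ᵥ y = c • y := by
    obtain ⟨s, hs⟩ := hK.exists_isotropic_add_smul hv₀.hform_self hy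
    have := hall hs
    rwa [mulVec_add, mulVec_smul, hc, smul_add, smul_comm s c, add_left_inj] at this
  refine ⟨c, mulVec_injective (funext fun y => ?_)⟩
  rw [smul_mulVec, one_mulVec]
  by_cases hy : hform y v₀ = 0
  · obtain ⟨f, hf, hvf⟩ := hK.exists_isotropic_hform_eq_one hv₀
    have hfv : hform f v₀ = 1 := by rw [← star_hform, hvf, star_one]
    have := hnp (y := y + f) (by simp [hy, hfv])
    rwa [mulVec_add, smul_add, hall hf, add_left_inj] at this
  · exact hnp hy

/-- If every vector perpendicular to w and u were isotropic, polarizing with 1 and with θ would kill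
the form on that complement. Nondegeneracy would then make the complement zero, leaving dimension at
most two. -/
theorem exists_anisotropic_perp (hK : HasSurjectiveNorm K) (hn : 3 ≤ Fintype.card ι) {w u : ι → K} (hw : IsIsotropic w)
    (hu : IsIsotropic u) (h : hform w u ≠ 0) :
    ∃ m, hform m w = 0 ∧ hform m u = 0 ∧ hform m m ≠ 0 := by
  by_contra! hall
  have h' : hform u w ≠ 0 := fun h0 => h (hform_eq_zero_symm h0)
  obtain ⟨θ, hθ, hs⟩ := hK.exists_skew
  have hpol {y z : ι → K} (hyw : hform y w = 0) (hyu : hform y u = 0) (hzw : hform z w = 0)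
      (hzu : hform z u = 0) : hform y z = 0 := by
    have e₁ := hall (y + z) (by simp [hyw, hzw]) (by simp [hyu, hzu])
    have e₂ := hall (y + θ • z) (by simp [hyw, hzw]) (by simp [hyu, hzu])
    simp only [hform_add_left, hform_add_right, hform_smul_left, hform_smul_right, hs,
      hall y hyw hyu, hall z hzw hzu] at e₁ e₂
    have : 2 * θ * hform y z = 0 := by linear_combination θ * e₁ - e₂
    exact (mul_eq_zero.1 this).resolve_left (mul_ne_zero hK.two_ne hθ)
  let π (z : ι → K) : ι → K := z - (hform z u / hform w u) • w - (hform z w / hform u w) • u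
  have hπw (z : ι → K) : hform (π z) w = 0 := by
    simp [π, hw.hform_self, h']
  have hπu (z : ι → K) : hform (π z) u = 0 := by
    simp [π, hu.hform_self, h]
  have hπ (z : ι → K) : π z = 0 := by
    refine hform_nondegenerate fun y => ?_
    have : y = π y + (hform y u / hform w u) • w + (hform y w / hform u w) • u := by
      simp only [π]
      abel
    rw [this]
    simp [hπw, hπu, hpol (hπw z) (hπu z) (hπw y) (hπu y)]
  have htop : Submodule.span K (Set.range ![w, u]) = ⊤ := by
    refine eq_top_iff.2 fun z _ => ?_
    have : z = (hform z u / hform w u) • w + (hform z w / hform u w) • u := by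
      have := hπ z
      simp only [π] at this
      rwa [sub_sub, sub_eq_zero] at this
    rw [this]
    exact add_mem (Submodule.smul_mem _ _ (Submodule.subset_span ⟨0, rfl⟩))
      (Submodule.smul_mem _ _ (Submodule.subset_span ⟨1, rfl⟩))
  have := finrank_range_le_card (R := K) ![w, u]
  rw [Set.finrank, htop, finrank_top, Module.finrank_fintype_fun_eq_card] at this
  simp at this
  omega

end HasSurjectiveNorm

end SpecialUnitary

/-! ### Transitivity of the group generated by Siegel unipotents. -/

section Generation

open Matrix

variable {K : Type*} [Field K] [StarRing K] {ι : Type*} [Fintype ι] [DecidableEq ι]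

variable (K ι) in
/-- The subgroup of the special unitary group generated by the unipotent elements `siegelSU`. -/
def siegelSubgroup : Subgroup (specialUnitaryGroup ι K) :=
  Subgroup.closure {g | ∃ (v m : ι → K) (c : K) (h : SiegelDatum v m c), g = siegelSU h}

theorem siegelSU_mem {v m : ι → K} {c : K} (h : SiegelDatum v m c) :
    siegelSU h ∈ siegelSubgroup K ι :=
  Subgroup.subset_closure ⟨v, m, c, h, rfl⟩

theorem SiegelDatum.transvection {v : ι → K} {c : K} (hv : hform v v = 0)
    (hc : c + star c = 0) : SiegelDatum v 0 c :=
  ⟨hv, by simp, by simp [hc]⟩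

/-- Two vectors of the same norm whose difference is isotropic are linked by a transvection. -/
theorem exists_transvection_mulVec_eq {w u : ι → K} (hwu : hform w w = hform u u)
    (htr : hform w u + hform u w = 2 * hform w w) (hne : hform w u ≠ hform w w) :
    ∃ (c : K) (h : SiegelDatum (w - u) 0 c), (siegelSU h).1 *ᵥ w = u := by
  have h0 : hform w w - hform w u ≠ 0 := sub_ne_zero.2 hne.symm
  have h1 : hform w w - hform u w ≠ 0 := fun h => h0 (by linear_combination -htr - h)
  -- The transvection sends w to w + c·h(w, w − u)(w − u), so c = −1/h(w, w − u) gives u. The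
  -- hypothesis `htr` says that h(w, w − u) is skew, so c is skew too.
  refine ⟨-(hform w w - hform w u)⁻¹, .transvection ?_ ?_, ?_⟩
  · simp only [hform_sub_left, hform_sub_right]
    linear_combination -htr - hwu
  · simp only [star_neg, star_inv₀, star_sub, star_hform]
    have : hform w w - hform u w = -(hform w w - hform w u) := by linear_combination -htr
    rw [this, inv_neg]
    ring
  · simp only [siegelSU_mulVec, hform_sub_right, hform_zero_right, smul_zero, add_zero, sub_zero,
      neg_mul, inv_mul_cancel₀ h0]
    simp

/-- The Siegel elements of e move f through all its hyperbolic partners: subtracting h(f',f)e from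
f' − f leaves a vector m orthogonal to both e and f, and f' = f + m + h(f',f)e. -/
theorem exists_siegel_fix_mulVec_eq {e f f' : ι → K} (he : IsIsotropic e) (hf : IsIsotropic f)
    (hf' : IsIsotropic f') (h : hform e f = 1) (h' : hform e f' = 1) :
    ∃ g ∈ siegelSubgroup K ι, g.1 *ᵥ e = e ∧ g.1 *ᵥ f = f' := by
  have hfe : hform f e = 1 := by rw [← star_hform, h, star_one]
  have hfe' : hform f' e = 1 := by rw [← star_hform, h', star_one]
  have hd : SiegelDatum e (f' - f - hform f' f • e) (hform f' f) := by
    refine ⟨he.hform_self, by simp [hfe, hfe', he.hform_self], ?_⟩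
    simp only [star_hform, hform_sub_left, hform_sub_right, hform_smul_left, hform_smul_right,
      he.hform_self, hf.hform_self, hf'.hform_self, h, h', hfe, hfe']
    ring
  refine ⟨siegelSU hd, siegelSU_mem hd, ?_, ?_⟩
  · simp [siegelSU_mulVec, he.hform_self, h, h']
  · simp only [siegelSU_mulVec, hfe, hform_sub_right, hform_smul_right, star_hform,
      hf.hform_self]
    module

namespace HasSurjectiveNorm

/-- Pass through an intermediate isotropic x with h(w,x) = h(x,u) = θ skew, so that transvections
link w to x and x to u. The component of x in span(w,u) is forced; a multiple of an anisotropic m,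
available in dimension at least three, corrects its norm to zero. -/
theorem exists_siegel_mulVec_eq_of_not_perp (hK : HasSurjectiveNorm K)
    (hn : 3 ≤ Fintype.card ι) {w u : ι → K} (hw : IsIsotropic w) (hu : IsIsotropic u)
    (h : hform w u ≠ 0) : ∃ g ∈ siegelSubgroup K ι, g.1 *ᵥ w = u := by
  have h' : hform u w ≠ 0 := fun h0 => h (hform_eq_zero_symm h0)
  obtain ⟨θ, hθ, hs⟩ := hK.exists_skew
  obtain ⟨m, hmw, hmu, hm⟩ := hK.exists_anisotropic_perp hn hw hu h
  obtain ⟨l, hl⟩ := hK.exists_norm (-(θ ^ 2 / hform w u + θ ^ 2 / hform u w) / hform m m) (by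
    simp only [star_div₀, star_neg, star_add, star_pow, star_hform, hs]
    ring)
  have hwm := hform_eq_zero_symm hmw
  have hum := hform_eq_zero_symm hmu
  set x := (θ / hform w u) • w + (-θ / hform u w) • u + l • m with hx
  have hwx : hform w x = θ := by
    simp only [hx, hform_add_right, hform_smul_right, hw.hform_self, hwm, star_div₀, star_neg,
      star_hform, hs]
    field_simp
    ring
  have hxu : hform x u = θ := by
    simp only [hx, hform_add_left, hform_smul_left, hu.hform_self, hmu]
    field_simp
    ring
  have hxw : hform x w = -θ := by rw [← star_hform, hwx, hs]
  have hux : hform u x = -θ := by rw [← star_hform, hxu, hs]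
  have hxx : hform x x = 0 := by
    have : hform x x = θ / hform w u * hform w x + (-θ / hform u w) * hform u x +
        l * hform m x := by
      conv_lhs => rw [hx, hform_add_left, hform_add_left, hform_smul_left, hform_smul_left,
        hform_smul_left, ← hx]
    have hmx : hform m x = star l * hform m m := by
      simp [hx, hmw, hmu]
    rw [this, hwx, hux, hmx, ← mul_assoc, hl]
    field_simp
    ring
  obtain ⟨c₁, d₁, e₁⟩ := exists_transvection_mulVec_eq (w := w) (u := x)
    (by rw [hw.hform_self, hxx]) (by rw [hwx, hxw, hw.hform_self]; ring)
    (by rwa [hwx, hw.hform_self])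
  obtain ⟨c₂, d₂, e₂⟩ := exists_transvection_mulVec_eq (w := x) (u := u)
    (by rw [hu.hform_self, hxx]) (by rw [hxu, hux, hxx]; ring) (by rwa [hxu, hxx])
  exact ⟨siegelSU d₂ * siegelSU d₁, mul_mem (siegelSU_mem d₂) (siegelSU_mem d₁), by
    rw [SU_mul_mulVec, e₁, e₂]⟩

theorem exists_siegel_mulVec_eq (hK : HasSurjectiveNorm K)
    (hn : 3 ≤ Fintype.card ι) {w u : ι → K} (hw : IsIsotropic w) (hu : IsIsotropic u) :
    ∃ g ∈ siegelSubgroup K ι, g.1 *ᵥ w = u := by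
  obtain ⟨z, hz, hzw, hzu⟩ := hK.exists_isotropic_not_perp hw hu
  obtain ⟨g₁, h₁, e₁⟩ := hK.exists_siegel_mulVec_eq_of_not_perp hn hz hw hzw
  obtain ⟨g₂, h₂, e₂⟩ := hK.exists_siegel_mulVec_eq_of_not_perp hn hz hu hzu
  refine ⟨g₂ * g₁⁻¹, mul_mem h₂ (inv_mem h₁), ?_⟩
  rw [SU_mul_mulVec, SU_inv_mulVec_eq.2 e₁.symm, e₂]

/-- The subgroup generated by the unipotent elements is transitive on hyperbolic pairs. -/
theorem exists_siegel_mulVec_pair_eq (hK : HasSurjectiveNorm K)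
    (hn : 3 ≤ Fintype.card ι) {e f e' f' : ι → K} (he : IsIsotropic e) (hf : IsIsotropic f)
    (he' : IsIsotropic e') (hf' : IsIsotropic f') (h : hform e f = 1) (h' : hform e' f' = 1) :
    ∃ g ∈ siegelSubgroup K ι, g.1 *ᵥ e = e' ∧ g.1 *ᵥ f = f' := by
  obtain ⟨g₁, h₁, e₁⟩ := hK.exists_siegel_mulVec_eq hn he he'
  obtain ⟨g₂, h₂, e₂, e₃⟩ := exists_siegel_fix_mulVec_eq he' (hf.map g₁) hf'
    (by rw [← e₁, SU_hform, h]) h'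
  exact ⟨g₂ * g₁, mul_mem h₂ h₁, by rw [SU_mul_mulVec, e₁, e₂], by rw [SU_mul_mulVec, e₃]⟩

/-- If the stabilizer of one hyperbolic pair consists of products of unipotent elements, so does
the whole group. -/
theorem siegelSubgroup_eq_top (hK : HasSurjectiveNorm K) (hn : 3 ≤ Fintype.card ι)
    {e f : ι → K} (he : IsIsotropic e) (hf : IsIsotropic f) (hef : hform e f = 1)
    (h : ∀ A : specialUnitaryGroup ι K, A.1 *ᵥ e = e → A.1 *ᵥ f = f → A ∈ siegelSubgroup K ι) :
    siegelSubgroup K ι = ⊤ := by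
  refine eq_top_iff.2 fun A _ => ?_
  obtain ⟨g, hg, h₁, h₂⟩ := hK.exists_siegel_mulVec_pair_eq hn he hf (he.map A) (hf.map A) hef
    (by rw [SU_hform, hef])
  rw [← mul_inv_cancel_left g A]
  refine mul_mem hg (h _ ?_ ?_)
  · rw [SU_mul_mulVec, SU_inv_mulVec_eq, h₁]
  · rw [SU_mul_mulVec, SU_inv_mulVec_eq, h₂]

end HasSurjectiveNorm

/-! ### Siegel unipotents are commutators. -/

section Perfect

/-- The involution inverting a hyperbolic pair and fixing its orthogonal complement. -/
theorem exists_neg_hyperbolic_pair {e f : ι → K} (he : IsIsotropic e) (hf : IsIsotropic f)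
    (h : hform e f = 1) : ∃ g : specialUnitaryGroup ι K, g.1 *ᵥ e = -e ∧
      ∀ m, hform m e = 0 → hform m f = 0 → g.1 *ᵥ m = m := by
  have h' : hform f e = 1 := by rw [← star_hform, h, star_one]
  -- M acts as −1 on the plane of e and f and as 1 on its complement, so its determinant is (−1)² =
  -- 1.
  let M : Matrix ι ι K := 1 + vecMulVec ((-2 : K) • e) (star f) + vecMulVec ((-2 : K) • f) (star e)
  have d (y z : ι → K) : star y ⬝ᵥ z = hform z y := dotProduct_comm _ _
  have hM (x : ι → K) : M *ᵥ x = x + (-2 * hform x f) • e + (-2 * hform x e) • f := by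
    simp only [M]
    rw [add_mulVec, add_mulVec, vecMulVec_mulVec, vecMulVec_mulVec, one_mulVec, d, d,
      op_smul_eq_smul, op_smul_eq_smul, smul_smul, smul_smul, mul_comm, mul_comm (hform x e)]
  refine ⟨⟨M, mem_specialUnitaryGroup_iff.2 ⟨mem_unitaryGroup_of_hform fun x y => ?_, ?_⟩⟩,
    ?_, fun m hme hmf => ?_⟩
  · simp only [hM, hform_add_left, hform_add_right, hform_smul_left, hform_smul_right, star_hform,
      StarMul.star_mul, he.hform_self, hf.hform_self, h, h', star_neg, star_ofNat]
    ring
  · simp only [M]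
    rw [det_one_add_vecMulVec_add_vecMulVec, d, d, d, d]
    simp only [hform_smul_left, he.hform_self, hf.hform_self, h, h']
    ring
  · simp only [hM, he.hform_self, h]
    module
  · simp [hM, hme, hmf]

namespace HasSurjectiveNorm

/-- Transvections are commutators inside the Siegel group of e. Modulo them a Siegel element is
determined by m, and the involution g maps its class to its inverse when m is orthogonal to f, so a
commutator with g realizes any such m. -/
theorem siegelSU_mem_commutator_of_pair (hK : HasSurjectiveNorm K) (hn : 3 ≤ Fintype.card ι)
    {e f m : ι → K} {c : K} (he : IsIsotropic e) (hf : IsIsotropic f) (hef : hform e f = 1)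
    (hd : SiegelDatum e m c) : siegelSU hd ∈ commutator (specialUnitaryGroup ι K) := by
  obtain ⟨g, hge, hg⟩ := exists_neg_hyperbolic_pair he hf hef
  have hcomm (x y : specialUnitaryGroup ι K) :
      x * y * x⁻¹ * y⁻¹ ∈ commutator (specialUnitaryGroup ι K) :=
    Subgroup.commutator_mem_commutator (Subgroup.mem_top x) (Subgroup.mem_top y)
  have exists_datum (m : ι → K) (hme : hform m e = 0) : ∃ c, SiegelDatum e m c := by
    obtain ⟨c, hc⟩ := hK.exists_add_star (-hform m m) (by simp)
    exact ⟨c, he.hform_self, hme, hc⟩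
  have h2 := hK.two_ne
  -- the transvections
  have htrans {a : K} (ha : SiegelDatum e 0 a) :
      siegelSU ha ∈ commutator (specialUnitaryGroup ι K) := by
    obtain ⟨m₀, hm₀e, -, hm₀⟩ := hK.exists_anisotropic_perp hn he hf (by simp [hef])
    have hsa : star a = -a := by
      have := ha.trace
      rw [hform_zero_left] at this
      linear_combination this
    obtain ⟨c₁, d₁⟩ := exists_datum m₀ hm₀e
    -- For m₂ = λm₀ the commutator is the transvection of parameter h(m₀,m₂) − h(m₂,m₀) = (λ̄ −
    -- λ)h(m₀,m₀). Since ā = −a, this λ gives exactly a.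
    obtain ⟨c₂, d₂⟩ := exists_datum ((-a / (2 * hform m₀ m₀)) • m₀) (by simp [hm₀e])
    have key : siegelSU d₁ * siegelSU d₂ = siegelSU ha * (siegelSU d₂ * siegelSU d₁) := by
      rw [siegelSU_mul, siegelSU_mul, siegelSU_mul]
      refine siegelSU_congr _ _ (by module) ?_
      simp only [hform_smul_left, hform_smul_right, hform_zero_right, star_div₀, star_neg, hsa,
        StarMul.star_mul, star_hform, star_ofNat]
      field_simp
      ring
    have := hcomm (siegelSU d₁) (siegelSU d₂)
    rwa [key, mul_assoc, mul_assoc, ← _root_.mul_inv_rev, mul_inv_cancel, mul_one] at this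
  -- vectors orthogonal to the hyperbolic pair
  have hperp {m : ι → K} {c : K} (hd : SiegelDatum e m c) (hmf : hform m f = 0) :
      siegelSU hd ∈ commutator (specialUnitaryGroup ι K) := by
    -- Conjugation by g replaces e by −e, that is m' by −m'. The commutator therefore has vector
    -- −2m', whence the factor −1/2.
    obtain ⟨c', d'⟩ := exists_datum ((-1 / 2 : K) • m) (by simp [hd.perp])
    have hgm := hg ((-1 / 2 : K) • m) (by simp [hd.perp]) (by simp [hmf])
    have hconj := hcomm g (siegelSU d')
    rw [conj_siegelSU, siegelSU_inv] at hconj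
    have d'' : SiegelDatum e ((1 / 2 : K) • m) c' := by
      refine ⟨he.hform_self, by simp [hd.perp], ?_⟩
      rw [d'.trace]
      simp only [hform_smul_left, hform_smul_right, star_div₀, star_neg, star_one, star_ofNat]
      ring
    have e₁ : siegelSU (d'.map g) = siegelSU d'' := by
      refine SU_ext fun x => ?_
      simp only [siegelSU_mulVec, hge, hgm, hform_neg_right, hform_smul_right, star_div₀,
        star_neg, star_one, star_ofNat]
      module
    rw [e₁, siegelSU_mul] at hconj
    have ha : SiegelDatum e 0 (c - (c' + star c' - hform (-((-1 / 2 : K) • m))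
        ((1 / 2 : K) • m))) := by
      refine .transvection he.hform_self ?_
      have t := hd.trace
      have t' := d'.trace
      simp only [hform_smul_left, hform_smul_right, hform_neg_left, star_sub, star_add, star_neg,
        star_star, star_div₀, star_one, star_ofNat, StarMul.star_mul, star_hform] at t t' ⊢
      have : (1 : K) = 2 / 2 := by field_simp
      linear_combination t - 2 * t' - hform m m * (1 + 2 / 2) * this
    have := mul_mem (htrans ha) hconj
    rw [siegelSU_mul] at this
    convert this using 1
    refine siegelSU_congr _ _ ?_ ?_
    · rw [zero_add, ← neg_smul, ← add_smul]
      have : (1 / 2 : K) + -(-1 / 2) = 1 := by field_simp; norm_num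
      rw [this, one_smul]
    · simp
  -- The vector m matters only modulo e: a shift along e is absorbed by a skew change of c, so m may
  -- be taken orthogonal to f.
  have hm : hform (m - hform m f • e) f = 0 := by simp [hef]
  have hd' : SiegelDatum e (m - hform m f • e) (c + hform m f - star (hform m f)) := by
    refine ⟨he.hform_self, by simp [hd.perp, he.hform_self], ?_⟩
    simp only [star_sub, star_add, star_star, hform_sub_left, hform_sub_right, hform_smul_left,
      hform_smul_right, hd.perp, hd.perp', he.hform_self]
    linear_combination hd.trace
  have : siegelSU hd = siegelSU hd' := by
    refine SU_ext fun x => ?_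
    simp only [siegelSU_mulVec, hform_sub_right, hform_smul_right]
    module
  rw [this]
  exact hperp hd' hm

theorem commutator_eq_top (hK : HasSurjectiveNorm K) (hn : 3 ≤ Fintype.card ι)
    (htop : siegelSubgroup K ι = ⊤) : commutator (specialUnitaryGroup ι K) = ⊤ := by
  rw [eq_top_iff, ← htop, siegelSubgroup, Subgroup.closure_le]
  rintro _ ⟨v, m, c, h, rfl⟩
  by_cases hv : v = 0
  · have : siegelSU h = 1 := SU_ext fun x => by simp [siegelSU_mulVec, hv]
    rw [this]
    exact one_mem _
  · obtain ⟨f, hf, hvf⟩ := hK.exists_isotropic_hform_eq_one ⟨hv, h.isotropic⟩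
    exact hK.siegelSU_mem_commutator_of_pair hn ⟨hv, h.isotropic⟩ hf hvf h

end HasSurjectiveNorm

end Perfect

end Generation

/-! ### Iwasawa's criterion and the center. -/

section Simplicity

open Matrix

variable {K : Type*} [Field K] [StarRing K] {ι : Type*} [Fintype ι] [DecidableEq ι]

/-- A perfect group that is the image of a set with central commutators is trivial. -/
theorem subsingleton_of_perfect_of_commutator_le_center {X : Type*} [Group X]
    (hp : commutator X = ⊤) (hc : ∀ x y z : X, x * y * x⁻¹ * y⁻¹ * z = z * (x * y * x⁻¹ * y⁻¹)) :
    Subsingleton X := by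
  have h₁ : commutator X ≤ Subgroup.center X := by
    rw [commutator_def, Subgroup.commutator_le]
    intro x _ y _
    exact Subgroup.mem_center_iff.2 fun z => (hc x y z).symm
  rw [hp, top_le_iff] at h₁
  have h₂ : commutator X = ⊥ := by
    rw [commutator_def, Subgroup.commutator_eq_bot_iff_le_centralizer]
    intro x _
    rw [Subgroup.mem_centralizer_iff]
    intro y _
    exact Subgroup.mem_center_iff.1 (h₁ ▸ Subgroup.mem_top x : x ∈ Subgroup.center X) y
  rw [h₂] at hp
  exact (Subgroup.subsingleton_iff).1 (subsingleton_of_bot_eq_top hp)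

/-- Commutators in the Siegel group of e have zero vector part, so they are transvections and
central in that group: its class is at most two. -/
theorem siegelSU_commutator_comm {e m₁ m₂ m₃ : ι → K} {c₁ c₂ c₃ : K} (d₁ : SiegelDatum e m₁ c₁)
    (d₂ : SiegelDatum e m₂ c₂) (d₃ : SiegelDatum e m₃ c₃) :
    siegelSU d₁ * siegelSU d₂ * (siegelSU d₁)⁻¹ * (siegelSU d₂)⁻¹ * siegelSU d₃ =
      siegelSU d₃ * (siegelSU d₁ * siegelSU d₂ * (siegelSU d₁)⁻¹ * (siegelSU d₂)⁻¹) := by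
  simp only [siegelSU_inv, siegelSU_mul]
  refine siegelSU_congr _ _ (by module) ?_
  simp
  ring

/-- If v and w = gv are perpendicular, choose an isotropic u orthogonal to v but not to w, and a
transvection T along u. As T fixes v, the commutator [T, g], which lies in N, sends w to Tw, and Tw
is not perpendicular to w. -/
theorem exists_mem_normal_not_perp (hK : HasSurjectiveNorm K)
    {N : Subgroup (specialUnitaryGroup ι K)} [hN : N.Normal] {g : specialUnitaryGroup ι K}
    (hg : g ∈ N) {v : ι → K} (hv : IsIsotropic v) (hgv : ∀ c : K, g.1 *ᵥ v ≠ c • v) :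
    ∃ n ∈ N, ∃ w, IsIsotropic w ∧ hform w (n.1 *ᵥ w) ≠ 0 := by
  set w := g.1 *ᵥ v with hw
  by_cases h : hform v w = 0
  swap
  · exact ⟨g, hg, v, hv, h⟩
  have hwi : IsIsotropic w := hv.map g
  obtain ⟨f, -, hf⟩ := hK.exists_isotropic_hform_eq_one hv
  have hfv : hform f v = 1 := by rw [← star_hform, hf, star_one]
  obtain ⟨y, hyv, hyw⟩ : ∃ y, hform y v = 0 ∧ hform y w ≠ 0 := by
    by_contra! hall
    refine hgv (hform w f) ?_
    rw [← sub_eq_zero]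
    refine hform_nondegenerate fun y => hform_eq_zero_symm ?_
    have := hall (y - hform y v • f) (by simp [hfv])
    simp only [hform_sub_left, hform_smul_left] at this
    rw [hform_sub_right, hform_smul_right, star_hform]
    linear_combination this
  obtain ⟨s, hs⟩ := hK.exists_isotropic_add_smul hwi.hform_self hyw
  set u := y + s • w with hu
  have huv : hform u v = 0 := by simp [hu, hyv, hform_eq_zero_symm h]
  have huw : hform u w ≠ 0 := by simpa [hu, hwi.hform_self] using hyw
  have hwu : hform w u ≠ 0 := fun h0 => huw (hform_eq_zero_symm h0)
  obtain ⟨θ, hθ, hsθ⟩ := hK.exists_skew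
  have d : SiegelDatum u 0 θ := .transvection hs.hform_self (by rw [hsθ, add_neg_cancel])
  have hTv : (siegelSU d).1 *ᵥ v = v := by
    simp [siegelSU_mulVec, hform_eq_zero_symm huv]
  refine ⟨siegelSU d * g * (siegelSU d)⁻¹ * g⁻¹, mul_mem (hN.conj_mem g hg _) (inv_mem hg), w,
    hwi, ?_⟩
  have : (siegelSU d * g * (siegelSU d)⁻¹ * g⁻¹).1 *ᵥ w = (siegelSU d).1 *ᵥ w := by
    rw [SU_mul_mulVec, SU_inv_mulVec_eq.2 hw, SU_mul_mulVec, SU_inv_mulVec_eq.2 hTv.symm,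
      SU_mul_mulVec]
  rw [this, siegelSU_mulVec]
  simp [hwi.hform_self, hsθ, hθ, huw, hwu]

namespace HasSurjectiveNorm

/-- A vector w not perpendicular to nw gives, after scaling, a hyperbolic pair. Carrying it to any
other pair conjugates n into an element of N joining two prescribed non-perpendicular lines;
perpendicular lines are joined through a third. -/
theorem exists_mem_normal_mulVec_eq (hK : HasSurjectiveNorm K) (hn : 3 ≤ Fintype.card ι)
    {N : Subgroup (specialUnitaryGroup ι K)} [hN : N.Normal] {g : specialUnitaryGroup ι K}
    (hg : g ∈ N) {v : ι → K} (hv : IsIsotropic v) (hgv : ∀ c : K, g.1 *ᵥ v ≠ c • v)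
    {x y : ι → K} (hx : IsIsotropic x) (hy : IsIsotropic y) :
    ∃ n ∈ N, ∃ c : K, c ≠ 0 ∧ n.1 *ᵥ x = c • y := by
  obtain ⟨n, hnN, w, hw, hnw⟩ := exists_mem_normal_not_perp hK hg hv hgv
  have key {x y : ι → K} (hx : IsIsotropic x) (hy : IsIsotropic y) (hxy : hform x y ≠ 0) :
      ∃ n ∈ N, ∃ c : K, c ≠ 0 ∧ n.1 *ᵥ x = c • y := by
    set a := star (hform w (n.1 *ᵥ w)) with ha
    set b := star (hform x y) with hb
    have ha0 : a ≠ 0 := star_ne_zero.2 hnw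
    have hb0 : b ≠ 0 := star_ne_zero.2 hxy
    obtain ⟨k, -, hk₁, hk₂⟩ := hK.exists_siegel_mulVec_pair_eq hn hw
      ((hw.map n).smul (inv_ne_zero ha0)) hx (hy.smul (inv_ne_zero hb0))
      (by simp [ha, hnw]) (by simp [hb, hxy])
    refine ⟨k * n * k⁻¹, hN.conj_mem n hnN k, a * b⁻¹, mul_ne_zero ha0 (inv_ne_zero hb0), ?_⟩
    rw [mulVec_smul] at hk₂
    rw [SU_mul_mulVec, SU_inv_mulVec_eq.2 hk₁.symm, SU_mul_mulVec, mul_smul, ← hk₂, smul_smul,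
      mul_inv_cancel₀ ha0, one_smul]
  obtain ⟨z, hz, hzx, hzy⟩ := hK.exists_isotropic_not_perp hx hy
  obtain ⟨n₁, h₁, c₁, hc₁, e₁⟩ := key hx hz fun h0 => hzx (hform_eq_zero_symm h0)
  obtain ⟨n₂, h₂, c₂, hc₂, e₂⟩ := key hz hy hzy
  refine ⟨n₂ * n₁, mul_mem h₂ h₁, c₁ * c₂, mul_ne_zero hc₁ hc₂, ?_⟩
  rw [SU_mul_mulVec, e₁, mulVec_smul, e₂, smul_smul]

/-- Iwasawa's argument: a normal subgroup that moves an isotropic line is everything. -/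
theorem normal_eq_top (hK : HasSurjectiveNorm K) (hn : 3 ≤ Fintype.card ι)
    (htop : siegelSubgroup K ι = ⊤) (N : Subgroup (specialUnitaryGroup ι K)) [hN : N.Normal]
    {g : specialUnitaryGroup ι K} (hg : g ∈ N) {e : ι → K} (he : IsIsotropic e)
    (hge : ∀ c : K, g.1 *ᵥ e ≠ c • e) : N = ⊤ := by
  let π := QuotientGroup.mk' N
  -- Q plays the role of the abelian normal subgroup of the point stabilizer in Iwasawa's criterion;
  -- class at most two suffices.
  let Q : Subgroup (specialUnitaryGroup ι K) :=
    { carrier := {s | ∃ (m : ι → K) (c : K) (d : SiegelDatum e m c), s = siegelSU d}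
      mul_mem' := by
        rintro _ _ ⟨m₁, c₁, d₁, rfl⟩ ⟨m₂, c₂, d₂, rfl⟩
        exact ⟨_, _, _, siegelSU_mul d₁ d₂⟩
      one_mem' := ⟨0, 0, .zero he.hform_self, (siegelSU_zero he.hform_self).symm⟩
      inv_mem' := by
        rintro _ ⟨m, c, d, rfl⟩
        exact ⟨_, _, _, siegelSU_inv d⟩ }
  have hQ : Q.map π = ⊤ := by
    rw [eq_top_iff, ← Subgroup.map_top_of_surjective π (QuotientGroup.mk'_surjective N), ← htop,
      siegelSubgroup, Subgroup.map_le_iff_le_comap, Subgroup.closure_le]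
    rintro _ ⟨v, m, c, d, rfl⟩
    by_cases hv : v = 0
    · have : siegelSU d = 1 := SU_ext fun x => by simp [siegelSU_mulVec, hv]
      rw [this]
      exact one_mem _
    obtain ⟨n, hnN, l, hl, hnv⟩ := hK.exists_mem_normal_mulVec_eq hn hg he hge ⟨hv, d.isotropic⟩ he
    have d₁ := d.map n
    -- With nv = le, the scalar l moves from the isotropic vector into the other parameters: (le,
    -- nm, c) and (e, l̄·nm, l·l̄·c) define the same element.
    have d₂ : SiegelDatum e (star l • (n.1 *ᵥ m)) (l * star l * c) := by
      refine ⟨he.hform_self, ?_, ?_⟩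
      · have := d₁.perp
        rw [hnv, hform_smul_right] at this
        rw [hform_smul_left, this]
      · have := d₁.trace
        simp only [StarMul.star_mul, star_star, hform_smul_left, hform_smul_right]
        linear_combination (l * star l) * this
    refine ⟨siegelSU d₂, ⟨_, _, _, rfl⟩, ?_⟩
    have h₁ : siegelSU d₂ = n * siegelSU d * n⁻¹ := by
      rw [conj_siegelSU]
      refine SU_ext fun x => ?_
      simp only [siegelSU_mulVec, hnv, hform_smul_right, star_star]
      module
    have hn1 : π n = 1 := (QuotientGroup.eq_one_iff n).2 hnN
    rw [h₁, map_mul, map_mul, map_inv, hn1, one_mul, inv_one, mul_one]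
  have hlift (x : specialUnitaryGroup ι K ⧸ N) :
      ∃ (m : ι → K) (c : K) (d : SiegelDatum e m c), π (siegelSU d) = x := by
    obtain ⟨_, ⟨m, c, d, rfl⟩, h⟩ := (hQ ▸ Subgroup.mem_top x : x ∈ Q.map π)
    exact ⟨m, c, d, h⟩
  have hperf : commutator (specialUnitaryGroup ι K ⧸ N) = ⊤ := by
    rw [commutator_def, ← Subgroup.map_top_of_surjective π (QuotientGroup.mk'_surjective N),
      ← Subgroup.map_commutator, ← commutator_def, hK.commutator_eq_top hn htop]
  have := subsingleton_of_perfect_of_commutator_le_center hperf fun x y z => by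
    obtain ⟨m₁, c₁, d₁, rfl⟩ := hlift x
    obtain ⟨m₂, c₂, d₂, rfl⟩ := hlift y
    obtain ⟨m₃, c₃, d₃, rfl⟩ := hlift z
    simp only [← map_mul, ← map_inv, siegelSU_commutator_comm d₁ d₂ d₃]
  exact QuotientGroup.subsingleton_iff.1 this

/-- A central element commutes with the transvections along every isotropic v, hence preserves every
isotropic line. -/
theorem mem_center_iff (hK : HasSurjectiveNorm K) {e : ι → K} (he : IsIsotropic e)
    {A : specialUnitaryGroup ι K} :
    A ∈ Subgroup.center (specialUnitaryGroup ι K) ↔ ∃ c : K, A.1 = c • 1 := by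
  constructor
  · intro hA
    refine hK.exists_eq_smul_one (fun v hv => ?_) he
    obtain ⟨θ, hθ, hsθ⟩ := hK.exists_skew
    have d : SiegelDatum v 0 θ := .transvection hv.hform_self (by rw [hsθ, add_neg_cancel])
    have h₁ : siegelSU (d.map A) = siegelSU d := by
      rw [← conj_siegelSU, ← Subgroup.mem_center_iff.1 hA, mul_inv_cancel_right]
    obtain ⟨x, hx⟩ := exists_hform_eq_one (hv.map A).ne_zero
    have := congrArg (fun B : specialUnitaryGroup ι K => B.1 *ᵥ x) h₁
    simp only [siegelSU_mulVec, hx, mulVec_zero, smul_zero, add_zero, hform_zero_right, sub_zero,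
      add_right_inj, mul_one] at this
    refine ⟨hform x v, ?_⟩
    rw [mul_smul] at this
    exact smul_right_injective _ hθ this
  · rintro ⟨c, hc⟩
    refine Subgroup.mem_center_iff.2 fun B => Subtype.ext ?_
    change B.1 * A.1 = A.1 * B.1
    rw [hc, mul_smul_one, smul_one_mul]

/-- The projective special unitary group is simple. -/
theorem isSimpleGroup_quotient_center (hK : HasSurjectiveNorm K) (hn : 3 ≤ Fintype.card ι)
    (htop : siegelSubgroup K ι = ⊤) {e : ι → K} (he : IsIsotropic e) :
    IsSimpleGroup (specialUnitaryGroup ι K ⧸ Subgroup.center (specialUnitaryGroup ι K)) := by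
  have hnt : Nontrivial (specialUnitaryGroup ι K ⧸ Subgroup.center (specialUnitaryGroup ι K)) := by
    rw [← not_subsingleton_iff_nontrivial, QuotientGroup.subsingleton_iff]
    intro hc
    obtain ⟨θ, hθ, hsθ⟩ := hK.exists_skew
    obtain ⟨f, hf, hef⟩ := hK.exists_isotropic_hform_eq_one he
    have hfe : hform f e = 1 := by rw [← star_hform, hef, star_one]
    have d : SiegelDatum e 0 θ := .transvection he.hform_self (by rw [hsθ, add_neg_cancel])
    obtain ⟨c, h⟩ := (hK.mem_center_iff he).1 (hc ▸ Subgroup.mem_top (siegelSU d))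
    -- The transvection maps f to f + θe, whose product with f is θ; a scalar would give zero.
    have := congrArg (fun B : Matrix ι ι K => hform (B *ᵥ f) f) h
    simp only [siegelSU_mulVec, smul_mulVec, one_mulVec, hform_add_left, hform_smul_left,
      hf.hform_self, hfe, hef, hform_zero_right, hform_zero_left] at this
    exact hθ (by linear_combination this)
  refine ⟨fun N hN => ?_⟩
  let π := QuotientGroup.mk' (Subgroup.center (specialUnitaryGroup ι K))
  have hπ : Function.Surjective π := QuotientGroup.mk'_surjective _
  by_cases h : ∀ g ∈ N.comap π, ∀ v, IsIsotropic v → ∃ c : K, g.1 *ᵥ v = c • v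
  · left
    rw [eq_bot_iff]
    intro x hx
    obtain ⟨g, rfl⟩ := hπ x
    exact (QuotientGroup.eq_one_iff g).2
      ((hK.mem_center_iff he).2 (hK.exists_eq_smul_one (h g hx) he))
  · right
    push Not at h
    obtain ⟨g, hg, v, hv, hgv⟩ := h
    have := hK.normal_eq_top hn htop (N.comap π) hg hv hgv
    rw [← Subgroup.map_comap_eq_self_of_surjective hπ N, this,
      Subgroup.map_top_of_surjective π hπ]

theorem not_commutative_quotient_center (hK : HasSurjectiveNorm K) (hn : 3 ≤ Fintype.card ι)
    (htop : siegelSubgroup K ι = ⊤) {e : ι → K} (he : IsIsotropic e) :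
    ¬ ∀ a b : specialUnitaryGroup ι K ⧸ Subgroup.center (specialUnitaryGroup ι K),
      a * b = b * a := by
  intro hc
  have := hK.isSimpleGroup_quotient_center hn htop he
  have hperf : commutator
      (specialUnitaryGroup ι K ⧸ Subgroup.center (specialUnitaryGroup ι K)) = ⊤ := by
    rw [commutator_def, ← Subgroup.map_top_of_surjective _ (QuotientGroup.mk'_surjective _),
      ← Subgroup.map_commutator, ← commutator_def, hK.commutator_eq_top hn htop]
  have h := subsingleton_of_perfect_of_commutator_le_center hperf fun x y z => hc _ _
  exact not_nontrivial _ this.toNontrivial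

end HasSurjectiveNorm

end Simplicity

/-! ### A computable model of the field with p² elements. -/

section QuadraticModel

open Matrix

/-- A computable model of the field with `p ^ 2` elements, when `a` is a nonsquare modulo `p`. -/
abbrev QuadField (p : ℕ) (a : ZMod p) : Type := QuadraticAlgebra (ZMod p) a 0

instance quadFieldFintype (p : ℕ) [NeZero p] (a : ZMod p) :
    Fintype (QuadraticAlgebra (ZMod p) a 0) :=
  Fintype.ofEquiv _ (QuadraticAlgebra.equivProd a 0).symm

theorem card_quadField (p : ℕ) [NeZero p] (a : ZMod p) :
    Fintype.card (QuadField p a) = p ^ 2 := by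
  rw [Fintype.ofEquiv_card, Fintype.card_prod, ZMod.card, sq]

/-- The quadratic model maps bijectively onto the Galois field, compatibly with the involutions. -/
theorem exists_quadField_hom (p : ℕ) [Fact p.Prime] (a : ZMod p) (hp : p ≠ 2) (ha : a ≠ 0)
    (hsq : a ^ (p ^ 2 / 2) = 1) (hirr : ∀ r : ZMod p, r ^ 2 ≠ a + 0 * r)
    (hstar : ∀ x : QuadField p a, x ^ p = star x) :
    ∃ φ : QuadField p a →+* GaloisField p 2,
      Function.Bijective φ ∧ ∀ x, φ (star x) = star (φ x) := by
  have := Fintype.ofFinite (GaloisField p 2)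
  have hcard : Fintype.card (GaloisField p 2) = p ^ 2 := by
    rw [← Nat.card_eq_fintype_card, GaloisField.card p 2 two_ne_zero]
  -- Euler's criterion in the field of order p²; for odd p the truncated quotient `p ^ 2 / 2` is (p²
  -- − 1)/2.
  obtain ⟨u, hu⟩ : IsSquare (algebraMap (ZMod p) (GaloisField p 2) a) := by
    rw [FiniteField.isSquare_iff, hcard, ← map_pow, hsq, map_one]
    · rwa [ringChar.eq (GaloisField p 2) p]
    · simpa using ha
  let φ : QuadField p a →ₐ[ZMod p] GaloisField p 2 :=
    QuadraticAlgebra.lift ⟨u, by rw [← hu, zero_smul, add_zero, Algebra.algebraMap_eq_smul_one]⟩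
  have : Fact (∀ r : ZMod p, r ^ 2 ≠ a + 0 * r) := ⟨hirr⟩
  refine ⟨φ.toRingHom, ?_, fun x => ?_⟩
  · rw [Fintype.bijective_iff_injective_and_card, hcard, card_quadField]
    exact ⟨φ.toRingHom.injective, rfl⟩
  · rw [← hstar, map_pow]
    rfl

theorem hasSurjectiveNorm_of_model {M K : Type*} [CommRing M] [StarRing M] [Field K] [StarRing K]
    {φ : M →+* K} (hφ : Function.Bijective φ) (hs : ∀ x, φ (star x) = star (φ x))
    (h2 : (2 : M) ≠ 0) (hskew : ∃ θ : M, θ ≠ 0 ∧ star θ = -θ)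
    (hnorm : ∀ k : M, star k = k → ∃ x, x * star x = k) : HasSurjectiveNorm K where
  two_ne := by
    rw [← map_ofNat φ 2]
    exact (map_ne_zero_iff φ hφ.1).2 h2
  exists_skew := by
    obtain ⟨θ, h, h'⟩ := hskew
    exact ⟨φ θ, (map_ne_zero_iff φ hφ.1).2 h, by rw [← hs, h', map_neg]⟩
  exists_norm k hk := by
    obtain ⟨k, rfl⟩ := hφ.2 k
    obtain ⟨x, hx⟩ := hnorm k (hφ.1 (by rw [hs, hk]))
    exact ⟨φ x, by rw [← hs, ← map_mul, hx]⟩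

theorem exists_quadField_hom_three : ∃ φ : QuadField 3 (-1) →+* GaloisField 3 2,
    Function.Bijective φ ∧ ∀ x, φ (star x) = star (φ x) :=
  exists_quadField_hom 3 (-1) (by decide) (by decide) (by decide) (by decide)
    (by decide +kernel)

theorem exists_quadField_hom_five : ∃ φ : QuadField 5 2 →+* GaloisField 5 2,
    Function.Bijective φ ∧ ∀ x, φ (star x) = star (φ x) :=
  exists_quadField_hom 5 2 (by decide) (by decide) (by decide) (by decide)
    (by decide +kernel)

theorem exists_quadField_hom_seven : ∃ φ : QuadField 7 (-1) →+* GaloisField 7 2,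
    Function.Bijective φ ∧ ∀ x, φ (star x) = star (φ x) :=
  exists_quadField_hom 7 (-1) (by decide) (by decide) (by decide) (by decide)
    (by decide +kernel)

theorem hasSurjectiveNorm_three : HasSurjectiveNorm (GaloisField 3 2) := by
  obtain ⟨φ, hφ, hs⟩ := exists_quadField_hom_three
  exact hasSurjectiveNorm_of_model hφ hs (by decide) (by decide +kernel) (by decide +kernel)

theorem hasSurjectiveNorm_five : HasSurjectiveNorm (GaloisField 5 2) := by
  obtain ⟨φ, hφ, hs⟩ := exists_quadField_hom_five
  exact hasSurjectiveNorm_of_model hφ hs (by decide) (by decide +kernel) (by decide +kernel)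

end QuadraticModel

/-! ### Generation in ranks three and four. -/

section SmallRank

open Matrix

variable {K : Type*} [Field K] [StarRing K] {ι : Type*} [Fintype ι] [DecidableEq ι]

theorem SU_inv_apply (A : specialUnitaryGroup ι K) (i j : ι) : (A⁻¹).1 i j = star (A.1 j i) := rfl

/-- A special unitary matrix fixing all but one of the standard basis vectors is trivial. -/
theorem SU_eq_one_of_fix {A : specialUnitaryGroup ι K} (k : ι)
    (h : ∀ j, j ≠ k → A.1 *ᵥ Pi.single j 1 = Pi.single j 1) : A = 1 := by
  have hcol (i j : ι) (hj : j ≠ k) : A.1 i j = (1 : Matrix ι ι K) i j := by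
    have := congrFun (h j hj) i
    rwa [mulVec_single_one, col_apply, Pi.single_apply, ← one_apply] at this
  have hrow (i : ι) (hi : i ≠ k) : A.1 i k = 0 := by
    have := congrFun (SU_inv_mulVec_eq.2 (h i hi).symm) k
    rw [mulVec_single_one, col_apply, SU_inv_apply, Pi.single_eq_of_ne hi.symm] at this
    exact star_eq_zero.1 this
  have hdiag : A.1 = diagonal fun i => if i = k then A.1 k k else 1 := by
    ext i j
    by_cases hj : j = k
    · subst hj
      by_cases hi : i = j
      · subst hi
        simp
      · rw [hrow i hi, diagonal_apply_ne _ hi]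
    · rw [hcol i j hj]
      by_cases hi : i = j
      · subst hi
        simp [hj]
      · rw [diagonal_apply_ne _ hi, one_apply_ne hi]
  have hk : A.1 k k = 1 := by
    have := (mem_specialUnitaryGroup_iff.1 A.2).2
    rw [hdiag, det_diagonal] at this
    simpa using this
  refine Subtype.ext (hdiag.trans ?_)
  simp [hk]

/-- The isotropic vectors `eᵢ + x eⱼ` and `(eᵢ - x eⱼ) / 2` form a hyperbolic pair whose
stabilizer fixes `eᵢ` and `eⱼ`. -/
theorem HasSurjectiveNorm.exists_standard_hyperbolic_pair (hK : HasSurjectiveNorm K) {i j : ι}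
    (hij : i ≠ j) : ∃ e f : ι → K, IsIsotropic e ∧ IsIsotropic f ∧ hform e f = 1 ∧
      ∀ A : specialUnitaryGroup ι K, A.1 *ᵥ e = e → A.1 *ᵥ f = f →
        A.1 *ᵥ Pi.single i 1 = Pi.single i 1 ∧ A.1 *ᵥ Pi.single j 1 = Pi.single j 1 := by
  obtain ⟨x, hx⟩ := hK.exists_norm (-1) (by simp)
  have h2 := hK.two_ne
  have hx0 : x ≠ 0 := by
    rintro rfl
    simp at hx
  have hs (k l : ι) : hform (Pi.single k 1 : ι → K) (Pi.single l 1) = if l = k then 1 else 0 := by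
    rw [hform_single_right, Pi.single_apply]
  let e : ι → K := Pi.single i 1 + x • Pi.single j 1
  let f : ι → K := (1 / 2 : K) • (Pi.single i 1 - x • Pi.single j 1)
  have hef : hform e f = 1 := by
    simp only [e, f, hform_add_left, hform_sub_right, hform_smul_left, hform_smul_right, hs,
      hij, hij.symm, if_true, if_false, star_div₀, star_one, star_ofNat]
    field_simp
    linear_combination -hx
  have hee : hform e e = 0 := by
    simp only [e, hform_add_left, hform_add_right, hform_smul_left, hform_smul_right, hs,
      hij, hij.symm, if_true, if_false]
    linear_combination hx
  have hff : hform f f = 0 := by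
    simp only [f, hform_sub_left, hform_sub_right, hform_smul_left, hform_smul_right, hs,
      hij, hij.symm, if_true, if_false]
    linear_combination (star (1 / 2 : K)) * (1 / 2) * hx
  have hfe : hform f e = 1 := by rw [← star_hform, hef, star_one]
  refine ⟨e, f, ⟨ne_zero_of_hform_ne_zero (y := f) (by simp [hef]), hee⟩,
    ⟨ne_zero_of_hform_ne_zero (y := e) (by simp [hfe]), hff⟩, hef, fun A hAe hAf => ?_⟩
  have hi : (Pi.single i 1 : ι → K) = (1 / 2 : K) • e + f := by
    simp only [e, f]
    rw [← smul_add, add_add_sub_cancel, ← two_smul K, smul_smul, one_div, inv_mul_cancel₀ h2,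
      one_smul]
  have hAi : A.1 *ᵥ Pi.single i 1 = Pi.single i 1 := by
    rw [hi, mulVec_add, mulVec_smul, hAe, hAf]
  have hj : (Pi.single j 1 : ι → K) = x⁻¹ • (e - Pi.single i 1) := by
    simp only [e]
    rw [add_sub_cancel_left, smul_smul, inv_mul_cancel₀ hx0, one_smul]
  exact ⟨hAi, by rw [hj, mulVec_smul, mulVec_sub, hAe, hAi]⟩

/-- The stabilizer of a standard hyperbolic pair fixes two basis vectors, and the determinant
condition makes it trivial. -/
theorem siegelSubgroup_eq_top_of_rank_three (hK : HasSurjectiveNorm K) :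
    siegelSubgroup K (Fin 3) = ⊤ := by
  obtain ⟨e, f, he, hf, hef, h⟩ :=
    hK.exists_standard_hyperbolic_pair (show (0 : Fin 3) ≠ 1 by decide)
  refine hK.siegelSubgroup_eq_top (by simp) he hf hef fun A hAe hAf => ?_
  obtain ⟨h₀, h₁⟩ := h A hAe hAf
  have : A = 1 := SU_eq_one_of_fix 2 fun j hj => by
    fin_cases j
    · exact h₀
    · exact h₁
    · exact absurd rfl hj
  rw [this]
  exact one_mem _

/-- Two unit vectors of a Hermitian plane that are linked by a nontrivial transvection. -/
def TransvectionLinked {M : Type*} [CommRing M] [StarRing M] (p q p' q' : M) : Prop :=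
  p' * star p' + q' * star q' = 1 ∧
    p * star p' + q * star q' + (p' * star p + q' * star q) = 2 ∧ p * star p' + q * star q' ≠ 1

instance decidableTransvectionLinked {M : Type*} [CommRing M] [StarRing M] [DecidableEq M]
    (p q p' q' : M) : Decidable (TransvectionLinked p q p' q') := by
  unfold TransvectionLinked
  infer_instance

theorem TransvectionLinked.map {M : Type*} [CommRing M] [StarRing M] {φ : M →+* K}
    (hφ : Function.Injective φ) (hs : ∀ x, φ (star x) = star (φ x)) {p q p' q' : M}
    (h : TransvectionLinked p q p' q') : TransvectionLinked (φ p) (φ q) (φ p') (φ q') := by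
  refine ⟨?_, ?_, fun h0 => h.2.2 (hφ ?_)⟩
  · simpa [hs] using congrArg φ h.1
  · have := congrArg φ h.2.1
    rw [map_ofNat φ 2] at this
    simpa [hs] using this
  · simpa [hs] using h0

theorem TransvectionLinked.exists_mulVec_eq {p q p' q' : K} (h : TransvectionLinked p q p' q')
    (hpq : p * star p + q * star q = 1) : ∃ g ∈ siegelSubgroup K (Fin 4),
      g.1 *ᵥ Pi.single 0 1 = Pi.single 0 1 ∧ g.1 *ᵥ Pi.single 1 1 = Pi.single 1 1 ∧
      g.1 *ᵥ ![0, 0, p, q] = ![0, 0, p', q'] := by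
  have hh (a b c d : K) : hform ![0, 0, a, b] ![0, 0, c, d] = a * star c + b * star d := by
    simp [hform, dotProduct, Fin.sum_univ_four]
  obtain ⟨c, d, hd⟩ := exists_transvection_mulVec_eq (w := ![0, 0, p, q]) (u := ![0, 0, p', q'])
    (by rw [hh, hh, hpq, h.1]) (by rw [hh, hh, hh, hpq, h.2.1, mul_one])
    (by rw [hh, hh, hpq]; exact h.2.2)
  refine ⟨siegelSU d, siegelSU_mem d, ?_, ?_, hd⟩ <;>
  · rw [siegelSU_mulVec]
    simp [hform, dotProduct, Fin.sum_univ_four]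

/-- The stabilizer acts as SU_2 on the last two coordinates. Three transvections bring the image of
the third basis vector back, after which three basis vectors are fixed; `hlink` makes this a finite
search in the plane. -/
theorem siegelSubgroup_eq_top_of_rank_four (hK : HasSurjectiveNorm K)
    (hlink : ∀ p q : K, p * star p + q * star q = 1 → ∃ p₁ q₁, TransvectionLinked p q p₁ q₁ ∧
      ∃ p₂ q₂, TransvectionLinked p₁ q₁ p₂ q₂ ∧ TransvectionLinked p₂ q₂ 1 0) :
    siegelSubgroup K (Fin 4) = ⊤ := by
  obtain ⟨e, f, he, hf, hef, h⟩ :=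
    hK.exists_standard_hyperbolic_pair (show (0 : Fin 4) ≠ 1 by decide)
  refine hK.siegelSubgroup_eq_top (by simp) he hf hef fun A hAe hAf => ?_
  obtain ⟨h₀, h₁⟩ := h A hAe hAf
  have hfix (i : Fin 4) (hi : A.1 *ᵥ Pi.single i 1 = Pi.single i 1) (hi2 : i ≠ 2) :
      A.1 i 2 = 0 := by
    have := congrFun (SU_inv_mulVec_eq.2 hi.symm) 2
    rw [mulVec_single_one, col_apply, SU_inv_apply, Pi.single_eq_of_ne hi2.symm] at this
    exact star_eq_zero.1 this
  have hA2 : A.1 *ᵥ Pi.single 2 1 = ![0, 0, A.1 2 2, A.1 3 2] := by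
    ext i
    rw [mulVec_single_one, col_apply]
    fin_cases i
    · exact hfix 0 h₀ (by decide)
    · exact hfix 1 h₁ (by decide)
    · rfl
    · rfl
  have hunit : A.1 2 2 * star (A.1 2 2) + A.1 3 2 * star (A.1 3 2) = 1 := by
    have := SU_hform A (Pi.single 2 1) (Pi.single 2 1)
    rw [hA2, hform_single_right, Pi.single_eq_same] at this
    simpa [hform, dotProduct, Fin.sum_univ_four] using this
  obtain ⟨p₁, q₁, l₁, p₂, q₂, l₂, l₃⟩ := hlink _ _ hunit
  obtain ⟨g₁, m₁, a₁, b₁, c₁⟩ := l₁.exists_mulVec_eq hunit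
  obtain ⟨g₂, m₂, a₂, b₂, c₂⟩ := l₂.exists_mulVec_eq l₁.1
  obtain ⟨g₃, m₃, a₃, b₃, c₃⟩ := l₃.exists_mulVec_eq l₂.1
  have hg : g₃ * g₂ * g₁ * A = 1 := SU_eq_one_of_fix 3 fun j hj => by
    simp only [SU_mul_mulVec]
    fin_cases j
    · change g₃.1 *ᵥ (g₂.1 *ᵥ (g₁.1 *ᵥ (A.1 *ᵥ Pi.single 0 1))) = Pi.single 0 1
      rw [h₀, a₁, a₂, a₃]
    · change g₃.1 *ᵥ (g₂.1 *ᵥ (g₁.1 *ᵥ (A.1 *ᵥ Pi.single 1 1))) = Pi.single 1 1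
      rw [h₁, b₁, b₂, b₃]
    · change g₃.1 *ᵥ (g₂.1 *ᵥ (g₁.1 *ᵥ (A.1 *ᵥ Pi.single 2 1))) = Pi.single 2 1
      rw [hA2, c₁, c₂, c₃]
      ext i
      fin_cases i <;> simp
    · exact absurd rfl hj
  rw [← inv_eq_iff_mul_eq_one] at hg
  rw [← hg]
  exact inv_mem (mul_mem (mul_mem m₃ m₂) m₁)

theorem siegelSubgroup_three_five : siegelSubgroup (GaloisField 5 2) (Fin 3) = ⊤ :=
  siegelSubgroup_eq_top_of_rank_three hasSurjectiveNorm_five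

theorem siegelSubgroup_four_three : siegelSubgroup (GaloisField 3 2) (Fin 4) = ⊤ := by
  obtain ⟨φ, hφ, hs⟩ := exists_quadField_hom_three
  have hlink : ∀ p q : QuadField 3 (-1), p * star p + q * star q = 1 →
      ∃ p₁ q₁, TransvectionLinked p q p₁ q₁ ∧
        ∃ p₂ q₂, TransvectionLinked p₁ q₁ p₂ q₂ ∧ TransvectionLinked p₂ q₂ 1 0 := by
    decide +kernel
  refine siegelSubgroup_eq_top_of_rank_four hasSurjectiveNorm_three fun p q hpq => ?_
  obtain ⟨p, rfl⟩ := hφ.2 p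
  obtain ⟨q, rfl⟩ := hφ.2 q
  obtain ⟨p₁, q₁, l₁, p₂, q₂, l₂, l₃⟩ := hlink p q (hφ.1 (by simpa [hs] using hpq))
  refine ⟨φ p₁, φ q₁, l₁.map hφ.1 hs, φ p₂, φ q₂, l₂.map hφ.1 hs, ?_⟩
  simpa using l₃.map hφ.1 hs

theorem exists_isotropic (hK : HasSurjectiveNorm K) {i j : ι} (hij : i ≠ j) :
    ∃ e : ι → K, IsIsotropic e := by
  obtain ⟨e, -, he, -⟩ := hK.exists_standard_hyperbolic_pair hij
  exact ⟨e, he⟩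

end SmallRank

/-! ### Characteristic polynomials of special unitary matrices. -/

section CharacteristicPolynomial

open Matrix Polynomial

/-- The coefficient of codegree k is, up to sign, a sum of k×k principal minors, hence homogeneous
of degree k. -/
theorem charpoly_smul_coeff {R ι : Type*} [CommRing R] [Fintype ι] [DecidableEq ι] (z : R)
    (A : Matrix ι ι R) {k : ℕ} (hk : k ≤ Fintype.card ι) :
    (z • A).charpoly.coeff (Fintype.card ι - k) =
      z ^ k * A.charpoly.coeff (Fintype.card ι - k) := by
  rw [charpoly_coeff_eq_sum_minors _ _ hk, charpoly_coeff_eq_sum_minors _ _ hk, mul_left_comm,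
    Finset.mul_sum _ _ (z ^ k)]
  congr 1
  apply Finset.sum_congr rfl
  intro s hs
  rw [submatrix_smul, Pi.smul_apply, Pi.smul_apply, det_smul, Fintype.card_coe,
    (Finset.mem_powersetCard.1 hs).2]

variable {K : Type*} [Field K] [StarRing K] {ι : Type*} [Fintype ι] [DecidableEq ι]

/-- The characteristic polynomial of a special unitary matrix is conjugate-reciprocal. -/
theorem SU_charpoly_coeff (A : specialUnitaryGroup ι K) {i : ℕ} (hi : i ≤ Fintype.card ι) :
    A.1.charpoly.coeff (Fintype.card ι - i) =
      (-1) ^ Fintype.card ι * star (A.1.charpoly.coeff i) := by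
  obtain ⟨hA, hdet⟩ := mem_specialUnitaryGroup_iff.1 A.2
  have hmul := mem_unitaryGroup_iff.1 hA
  have hinv : A.1⁻¹ = star A.1 := inv_eq_right_inv hmul
  have h₁ := charpoly_inv A.1 ((isUnit_iff_isUnit_det _).2 (by simp [hdet]))
  rw [hdet, Ring.inverse_one, C_1, mul_one, hinv] at h₁
  have h₂ : (star A.1).charpoly = A.1.charpoly.map (starRingEnd K) := by
    rw [star_eq_conjTranspose, conjTranspose, transpose_map, charpoly_transpose, ← charpoly_map]
    rfl
  rw [h₂] at h₁
  have h₃ := congrArg (fun p => p.coeff i) h₁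
  rw [← reverse_charpoly] at h₃
  simp only [coeff_map, starRingEnd_apply] at h₃
  rw [show ((-1 : K[X]) ^ Fintype.card ι) = C ((-1) ^ Fintype.card ι) by simp, coeff_C_mul,
    coeff_reverse, charpoly_natDegree_eq_dim, revAt_le hi] at h₃
  rw [h₃, ← mul_assoc, ← mul_pow]
  simp

theorem cayley_hamilton (A : Matrix ι ι K) :
    ∑ i ∈ Finset.range (Fintype.card ι + 1), A.charpoly.coeff i • A ^ i = 0 := by
  rw [← aeval_self_charpoly A, aeval_eq_sum_range, charpoly_natDegree_eq_dim]

theorem charpoly_coeff_card (A : Matrix ι ι K) : A.charpoly.coeff (Fintype.card ι) = 1 := by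
  have := A.charpoly_monic.coeff_natDegree
  rwa [charpoly_natDegree_eq_dim] at this

/-- Conjugate reciprocity leaves a single free parameter t = −coeff 2, the trace. -/
theorem SU_three_cayley_hamilton (A : specialUnitaryGroup (Fin 3) K) :
    A.1 ^ 3 = -A.1.charpoly.coeff 2 • A.1 ^ 2 - star (-A.1.charpoly.coeff 2) • A.1 + 1 := by
  have h₀ := SU_charpoly_coeff A (i := 3) (by simp)
  have h₁ := SU_charpoly_coeff A (i := 2) (by simp)
  have h₃ := charpoly_coeff_card A.1
  have h := cayley_hamilton A.1
  simp only [Fintype.card_fin] at h₀ h₁ h₃ h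
  norm_num at h₀ h₁
  rw [h₃] at h₀
  simp only [Finset.sum_range_succ, Finset.sum_range_zero, h₀, h₁, h₃, pow_zero, pow_one,
    star_one, one_smul] at h
  rw [← sub_eq_zero, ← h, star_neg]
  module

theorem SU_four_cayley_hamilton (A : specialUnitaryGroup (Fin 4) K) :
    A.1 ^ 4 = -A.1.charpoly.coeff 3 • A.1 ^ 3 - A.1.charpoly.coeff 2 • A.1 ^ 2 +
      star (-A.1.charpoly.coeff 3) • A.1 - 1 := by
  have h₀ := SU_charpoly_coeff A (i := 4) (by simp)
  have h₁ := SU_charpoly_coeff A (i := 3) (by simp)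
  have h₃ := charpoly_coeff_card A.1
  have h := cayley_hamilton A.1
  simp only [Fintype.card_fin] at h₀ h₁ h₃ h
  norm_num at h₀ h₁
  rw [h₃] at h₀
  simp only [Finset.sum_range_succ, Finset.sum_range_zero, h₀, h₁, h₃, pow_zero, pow_one,
    star_one, one_smul] at h
  rw [← sub_eq_zero, ← h, star_neg]
  module

theorem SU_four_star_coeff_two (A : specialUnitaryGroup (Fin 4) K) :
    star (A.1.charpoly.coeff 2) = A.1.charpoly.coeff 2 := by
  have h₁ := SU_charpoly_coeff A (i := 2) (by simp)
  simp only [Fintype.card_fin] at h₁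
  norm_num at h₁
  exact h₁.symm

end CharacteristicPolynomial

/-! ### Powers modulo the characteristic polynomial. -/

section PowerReduction

variable {M : Type*} [CommRing M] [StarRing M]

/-- The coefficients of `X ^ k` modulo `X ^ 3 - t X ^ 2 + t̄ X - 1`. -/
def cubicPow (t : M) : ℕ → M × M × M
  | 0 => (0, 0, 1)
  | k + 1 =>
    let x := cubicPow t k
    (x.1 * t + x.2.1, x.2.2 - x.1 * star t, x.1)

/-- The coefficients of `X ^ k` modulo `X ^ 4 - t X ^ 3 + s X ^ 2 - t̄ X + 1`. -/
def quarticPow (t s : M) : ℕ → M × M × M × M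
  | 0 => (0, 0, 0, 1)
  | k + 1 =>
    let x := quarticPow t s k
    (x.1 * t + x.2.1, x.2.2.1 - x.1 * s, x.2.2.2 + x.1 * star t, -x.1)

variable {K R : Type*} [CommRing K] [StarRing K] [Ring R] [Algebra K R] {φ : M →+* K}

/-- When the first two coefficients vanish, A^k is scalar, a test that depends on t alone. -/
theorem pow_eq_cubicPow (hs : ∀ x, φ (star x) = star (φ x)) {t : M} {A : R}
    (h : A ^ 3 = φ t • A ^ 2 - star (φ t) • A + 1) (k : ℕ) :
    A ^ k = φ (cubicPow t k).1 • A ^ 2 + φ (cubicPow t k).2.1 • A +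
      φ (cubicPow t k).2.2 • (1 : R) := by
  induction k with
  | zero => simp [cubicPow]
  | succ k ih =>
    rw [pow_succ, ih, add_mul, add_mul, smul_mul_assoc, smul_mul_assoc, smul_mul_assoc, ← pow_succ,
      ← sq, one_mul, h]
    simp only [cubicPow, map_add, map_sub, map_mul, hs]
    module

theorem pow_eq_quarticPow (hs : ∀ x, φ (star x) = star (φ x)) {t s : M} {A : R}
    (h : A ^ 4 = φ t • A ^ 3 - φ s • A ^ 2 + star (φ t) • A - 1) (k : ℕ) :
    A ^ k = φ (quarticPow t s k).1 • A ^ 3 + φ (quarticPow t s k).2.1 • A ^ 2 +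
      φ (quarticPow t s k).2.2.1 • A + φ (quarticPow t s k).2.2.2 • (1 : R) := by
  induction k with
  | zero => simp [quarticPow]
  | succ k ih =>
    rw [pow_succ, ih, add_mul, add_mul, add_mul, smul_mul_assoc, smul_mul_assoc, smul_mul_assoc,
      smul_mul_assoc, ← pow_succ, ← pow_succ, ← sq, one_mul, h]
    simp only [quarticPow, map_add, map_sub, map_mul, map_neg, hs]
    module

end PowerReduction

/-! ### Enumeration of scalar powers. -/

section UnitaryPowers

open Matrix

/-- An enumeration over the 25 traces. The last clause says that in the order-7 case the conjugate
trace differs from the trace even up to a cube root of unity, the ambiguity left by the center. -/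
theorem SU_three_five_pow (A : SU 3 5) :
    (∃ k ∈ [6, 8, 10], ∃ c : GaloisField 5 2, A.1 ^ k = c • 1) ∨
      (∃ c : GaloisField 5 2, A.1 ^ 7 = c • 1) ∧ ∀ z, z ^ 3 = 1 →
        star (A.1.charpoly.coeff 2) ≠ z * A.1.charpoly.coeff 2 := by
  obtain ⟨φ, hφ, hs⟩ := exists_quadField_hom_five
  have key : ∀ t : QuadField 5 2,
      (∃ k ∈ [6, 8, 10], (cubicPow t k).1 = 0 ∧ (cubicPow t k).2.1 = 0) ∨
      ((cubicPow t 7).1 = 0 ∧ (cubicPow t 7).2.1 = 0) ∧ ∀ z, z ^ 3 = 1 → star t ≠ z * t := by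
    decide +kernel
  obtain ⟨t, ht⟩ := hφ.2 (-A.1.charpoly.coeff 2)
  have hpow := pow_eq_cubicPow hs (ht ▸ SU_three_cayley_hamilton A)
  have hscalar {k : ℕ} (h : (cubicPow t k).1 = 0 ∧ (cubicPow t k).2.1 = 0) :
      ∃ c : GaloisField 5 2, A.1 ^ k = c • 1 := ⟨φ (cubicPow t k).2.2, by rw [hpow k, h.1, h.2]; simp⟩
  refine (key t).imp (fun ⟨k, hk, h⟩ => ⟨k, hk, hscalar h⟩) fun ⟨h, h'⟩ => ⟨hscalar h, ?_⟩
  intro z hz h0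
  obtain ⟨z, rfl⟩ := hφ.2 z
  refine h' z (hφ.1 (by simpa using hz)) (hφ.1 ?_)
  rw [hs, map_mul, ht, star_neg, h0]
  ring

/-- The same over pairs (t, s) with s self-conjugate. Here z is a fourth root of unity and both
coefficients must be compared, because t alone may be compatible with its conjugate. -/
theorem SU_four_three_pow (A : SU 4 3) :
    (∃ k ∈ [72, 5], ∃ c : GaloisField 3 2, A.1 ^ k = c • 1) ∨
      (∃ c : GaloisField 3 2, A.1 ^ 7 = c • 1) ∧ ∀ z, z ^ 4 = 1 →
        star (A.1.charpoly.coeff 3) = z * A.1.charpoly.coeff 3 →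
        star (A.1.charpoly.coeff 2) ≠ z ^ 2 * A.1.charpoly.coeff 2 := by
  obtain ⟨φ, hφ, hs⟩ := exists_quadField_hom_three
  have key : ∀ t s : QuadField 3 (-1), star s = s →
      (∃ k ∈ [72, 5], (quarticPow t s k).1 = 0 ∧ (quarticPow t s k).2.1 = 0 ∧
        (quarticPow t s k).2.2.1 = 0) ∨
      ((quarticPow t s 7).1 = 0 ∧ (quarticPow t s 7).2.1 = 0 ∧ (quarticPow t s 7).2.2.1 = 0) ∧
        ∀ z, z ^ 4 = 1 → star t = z * t → star s ≠ z ^ 2 * s := by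
    decide +kernel
  obtain ⟨t, ht⟩ := hφ.2 (-A.1.charpoly.coeff 3)
  obtain ⟨s, hs2⟩ := hφ.2 (A.1.charpoly.coeff 2)
  have hpow := pow_eq_quarticPow hs (hs2 ▸ ht ▸ SU_four_cayley_hamilton A)
  have hscalar {k : ℕ} (h : (quarticPow t s k).1 = 0 ∧ (quarticPow t s k).2.1 = 0 ∧
        (quarticPow t s k).2.2.1 = 0) : ∃ c : GaloisField 3 2, A.1 ^ k = c • 1 :=
    ⟨φ (quarticPow t s k).2.2.2, by rw [hpow k, h.1, h.2.1, h.2.2]; simp⟩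
  refine (key t s (hφ.1 ?_)).imp (fun ⟨k, hk, h⟩ => ⟨k, hk, hscalar h⟩)
    fun ⟨h, h'⟩ => ⟨hscalar h, ?_⟩
  · rw [hs, hs2, SU_four_star_coeff_two]
  intro z hz h0 h1
  obtain ⟨z, rfl⟩ := hφ.2 z
  refine h' z (hφ.1 (by simpa using hz)) (hφ.1 ?_) (hφ.1 ?_)
  · rw [hs, map_mul, ht, star_neg, h0]
    ring
  · rw [hs, map_mul, map_pow, hs2, h1]

end UnitaryPowers

/-! ### The semilinear coset of the inner automorphisms. -/

section SemilinearAutomorphisms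

open Matrix

variable {n p : ℕ} [Fact p.Prime]

/-- The projection of the special unitary group onto its central quotient. -/
noncomputable abbrev toPSU (n p : ℕ) [Fact p.Prime] : SU n p →* PSU n p :=
  QuotientGroup.mk' (Subgroup.center (SU n p))

theorem toPSU_surjective : Function.Surjective (toPSU n p) := QuotientGroup.mk'_surjective _

theorem semilinearAut_toPSU (D : GU n p) (A : SU n p) :
    semilinearAut n p D (toPSU n p A) = toPSU n p (conjSU n p D (frobSU n p A)) := rfl

theorem conjSU_frobSU_val (D : GU n p) (A : SU n p) :
    (conjSU n p D (frobSU n p A)).1 =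
      D.1 * A.1.map (starRingEnd (GaloisField p 2)) * (D⁻¹).1 := rfl

theorem GU_mul_inv_val (D : GU n p) : D.1 * (D⁻¹).1 = 1 := by
  rw [← Submonoid.coe_mul, mul_inv_cancel, Submonoid.coe_one]

theorem GU_inv_mul_val (D : GU n p) : (D⁻¹).1 * D.1 = 1 := by
  rw [← Submonoid.coe_mul, inv_mul_cancel, Submonoid.coe_one]

/-- The inclusion of the special unitary group into the unitary group. -/
def SUtoGU (A : SU n p) : GU n p := ⟨A.1, A.2.1⟩

theorem SUtoGU_inv_val (A : SU n p) : ((SUtoGU A)⁻¹).1 = (A⁻¹).1 := rfl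

/-- Hence the whole coset Inn·τ_D consists of semilinear automorphisms, and it is enough to study a
single τ_E. -/
theorem conj_mul_semilinearAut (D : GU n p) (X : SU n p) :
    MulAut.conj (toPSU n p X) * semilinearAut n p D = semilinearAut n p (SUtoGU X * D) := by
  ext x
  obtain ⟨A, rfl⟩ := toPSU_surjective x
  rw [MulAut.mul_apply, semilinearAut_toPSU, semilinearAut_toPSU, MulAut.conj_apply, ← map_mul,
    ← map_inv, ← map_mul]
  congr 1
  refine Subtype.ext ?_
  change X.1 * (D.1 * A.1.map (starRingEnd (GaloisField p 2)) * (D⁻¹).1) * (X⁻¹).1 =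
    (X.1 * D.1) * A.1.map (starRingEnd (GaloisField p 2)) * ((SUtoGU X * D)⁻¹).1
  rw [_root_.mul_inv_rev, Submonoid.coe_mul, SUtoGU_inv_val]
  simp only [mul_assoc]

theorem semilinearAut_mul_conj (D : GU n p) (x : PSU n p) :
    semilinearAut n p D * MulAut.conj x =
      MulAut.conj (semilinearAut n p D x) * semilinearAut n p D := by
  ext y
  simp [MulAut.mul_apply]

theorem map_map_star {K ι : Type*} [Field K] [StarRing K] (A : Matrix ι ι K) :
    (A.map (starRingEnd K)).map (starRingEnd K) = A := by
  ext i j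
  simp

/-- The square of a semilinear automorphism is inner. -/
theorem semilinearAut_sq_mem_range_conj (D : GU n p) :
    semilinearAut n p D * semilinearAut n p D ∈
      (MulAut.conj : PSU n p →* MulAut (PSU n p)).range := by
  let D' : GU n p := ⟨D.1.map (starRingEnd (GaloisField p 2)),
    (UnitaryGroup.map_star D).2⟩
  have hD' : (D'⁻¹).1 = (D⁻¹).1.map (starRingEnd (GaloisField p 2)) := by
    ext i j
    simp [D', star_apply, starRingEnd_apply]
  have hdet : (D.1 * D'.1).det = 1 := by
    change (D.1 * D.1.map (starRingEnd (GaloisField p 2))).det = 1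
    rw [det_mul, ← RingHom.mapMatrix_apply, ← RingHom.map_det]
    exact (det_of_mem_unitary D.2).2
  -- The square of τ_D is conjugation by D·D^(p), whose determinant is the norm of det D and so
  -- equals 1.
  let X : SU n p := ⟨D.1 * D'.1, mem_specialUnitaryGroup_iff.2 ⟨mul_mem D.2 D'.2, hdet⟩⟩
  refine ⟨toPSU n p X, ?_⟩
  ext x
  obtain ⟨A, rfl⟩ := toPSU_surjective x
  rw [MulAut.mul_apply, semilinearAut_toPSU, semilinearAut_toPSU, MulAut.conj_apply, ← map_mul,
    ← map_inv, ← map_mul]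
  congr 1
  refine Subtype.ext ?_
  change D.1 * D'.1 * A.1 * ((D * D')⁻¹).1 = D.1 * (D.1 * A.1.map (starRingEnd (GaloisField p 2)) *
    (D⁻¹).1).map (starRingEnd (GaloisField p 2)) * (D⁻¹).1
  rw [Matrix.map_mul, Matrix.map_mul, map_map_star, ← hD', _root_.mul_inv_rev, Submonoid.coe_mul]
  simp only [mul_assoc]
  rfl

theorem mem_sup_zpowers_of_sq_mem {G : Type*} [Group G] {N : Subgroup G} [hN : N.Normal] {t : G}
    (ht : t * t ∈ N) {g : G} (hg : g ∈ N ⊔ Subgroup.zpowers t) : g ∈ N ∨ ∃ x ∈ N, g = x * t := by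
  rw [← SetLike.mem_coe, Subgroup.normal_mul] at hg
  obtain ⟨x, hx, _, ⟨k, rfl⟩, rfl⟩ := hg
  change x * t ^ k ∈ N ∨ _
  obtain ⟨m, rfl | rfl⟩ := Int.even_or_odd' k
  · left
    rw [_root_.zpow_mul, zpow_ofNat, sq]
    exact mul_mem hx (zpow_mem ht m)
  · right
    refine ⟨x * (t * t) ^ m, mul_mem hx (zpow_mem ht m), ?_⟩
    change x * t ^ (2 * m + 1) = _
    rw [_root_.zpow_add_one, _root_.zpow_mul, zpow_ofNat, sq, mul_assoc]

theorem relIndex_sup_zpowers_eq_two {G : Type*} [Group G] {N : Subgroup G} [hN : N.Normal] {t : G}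
    (ht : t * t ∈ N) (ht' : t ∉ N) : N.relIndex (N ⊔ Subgroup.zpowers t) = 2 := by
  have htm : t ∈ N ⊔ Subgroup.zpowers t :=
    Subgroup.mem_sup_right (Subgroup.mem_zpowers t)
  rw [Subgroup.relIndex, Subgroup.index_eq_two_iff]
  refine ⟨⟨t, htm⟩, fun b => ?_⟩
  simp only [Subgroup.mem_subgroupOf, Subgroup.coe_mul]
  rcases mem_sup_zpowers_of_sq_mem ht b.2 with hb | ⟨x, hx, hb⟩
  · exact Or.inr ⟨hb, fun h => ht' ((mul_mem_cancel_left hb).1 h)⟩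
  · refine Or.inl ⟨?_, fun h => ht' ?_⟩
    · rw [hb, mul_assoc]
      exact mul_mem hx ht
    · rwa [hb, mul_mem_cancel_left hx] at h

instance range_conj_normal (G : Type*) [Group G] : (MulAut.conj : G →* MulAut G).range.Normal := by
  refine ⟨?_⟩
  rintro _ ⟨x, rfl⟩ g
  refine ⟨g x, ?_⟩
  ext y
  simp [MulAut.mul_apply]

theorem mem_PSUDotTwo {D : GU n p} {g : MulAut (PSU n p)} (hg : g ∈ PSUDotTwo n p D) :
    (∃ x, MulAut.conj x = g) ∨ ∃ E : GU n p, g = semilinearAut n p E := by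
  refine (mem_sup_zpowers_of_sq_mem (semilinearAut_sq_mem_range_conj D) hg).imp id ?_
  rintro ⟨_, ⟨x, rfl⟩, rfl⟩
  obtain ⟨X, rfl⟩ := toPSU_surjective x
  exact ⟨SUtoGU X * D, conj_mul_semilinearAut D X⟩

theorem conj_mem_PSUDotTwo (D : GU n p) (x : PSU n p) : MulAut.conj x ∈ PSUDotTwo n p D :=
  Subgroup.mem_sup_left ⟨x, rfl⟩

/-- The quotient E·D⁻¹ lies in SU, so the extension depends on D only through its determinant. -/
theorem semilinearAut_mem_PSUDotTwo {D E : GU n p} (h : E.1.det = D.1.det) :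
    semilinearAut n p E ∈ PSUDotTwo n p D := by
  have hdet : (E.1 * (D⁻¹).1).det = 1 := by
    rw [det_mul, h, ← det_mul, GU_mul_inv_val, det_one]
  let X : SU n p := ⟨E.1 * (D⁻¹).1, mem_specialUnitaryGroup_iff.2 ⟨mul_mem E.2 (D⁻¹).2, hdet⟩⟩
  have : E = SUtoGU X * D := (inv_mul_cancel_right E D).symm
  rw [this, ← conj_mul_semilinearAut]
  exact mul_mem (conj_mem_PSUDotTwo D _)
    (Subgroup.mem_sup_right (Subgroup.mem_zpowers _))

/-- A semilinear automorphism fixing the class of `B` relates the characteristic polynomial of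
`B` to its conjugate. -/
theorem star_charpoly_coeff_of_fixed
    (hc : ∀ A ∈ Subgroup.center (SU n p), ∃ c : GaloisField p 2, A.1 = c • 1)
    {E : GU n p} {B : SU n p} (h : semilinearAut n p E (toPSU n p B) = toPSU n p B) :
    ∃ z : GaloisField p 2, z ^ n = 1 ∧ ∀ k ≤ n,
      star (B.1.charpoly.coeff (n - k)) = z ^ k * B.1.charpoly.coeff (n - k) := by
  rw [semilinearAut_toPSU] at h
  -- A fixed class means E·B^(p)·E⁻¹ = zB for a scalar z. Thus zB is similar to B^(p), and
  -- determinants give z^n = 1.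
  obtain ⟨z, hz⟩ := hc _ ((QuotientGroup.eq).1 h.symm)
  have hX : (conjSU n p E (frobSU n p B)).1 = z • B.1 := by
    have : conjSU n p E (frobSU n p B) = B * (B⁻¹ * conjSU n p E (frobSU n p B)) :=
      (mul_inv_cancel_left _ _).symm
    rw [this, Submonoid.coe_mul, hz, mul_smul_one]
  have hdet : z ^ n = 1 := by
    have := congrArg det hz
    rw [(mem_specialUnitaryGroup_iff.1 (Subtype.prop _)).2, det_smul, det_one, mul_one,
      Fintype.card_fin] at this
    exact this.symm
  have hchar : (z • B.1).charpoly = B.1.charpoly.map (starRingEnd (GaloisField p 2)) := by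
    rw [← hX, conjSU_frobSU_val, mul_assoc, charpoly_mul_comm, mul_assoc, GU_inv_mul_val, mul_one,
      charpoly_map]
  refine ⟨z, hdet, fun k hk => ?_⟩
  have := charpoly_smul_coeff z B.1 (k := k) (by simpa using hk)
  rw [hchar, Fintype.card_fin, Polynomial.coeff_map, starRingEnd_apply] at this
  exact this

end SemilinearAutomorphisms

/-! ### The common prime graph. -/

section PrimeGraphs

/-- The conditions saying that the prime graph of `G` has vertices `2, 3, 5, 7` and exactly the
edges `2 - 3` and `2 - 5`. -/
structure HasPathPrimeGraph (G : Type*) [Group G] : Prop where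
  order_prime : ∀ g : G, (orderOf g).Prime → orderOf g ∈ ({2, 3, 5, 7} : Set ℕ)
  order_mul : ∀ (g : G) (p q : ℕ), p.Prime → q.Prime → p ≠ q → orderOf g = p * q →
    p * q = 6 ∨ p * q = 10
  six : ∃ g : G, orderOf g = 6
  seven : ∃ g : G, orderOf g = 7
  ten : ∃ g : G, orderOf g = 10

theorem prime_pair_of_mul_eq {p q : ℕ} (hp : p.Prime) (hq : q.Prime)
    (h : p * q = 6 ∨ p * q = 10) :
    p = 2 ∧ q = 3 ∨ p = 3 ∧ q = 2 ∨ p = 2 ∧ q = 5 ∨ p = 5 ∧ q = 2 := by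
  have hp10 : p ≤ 10 := by
    rcases h with h | h
    · exact (Nat.le_of_dvd (by norm_num) (Dvd.intro q h)).trans (by norm_num)
    · exact Nat.le_of_dvd (by norm_num) (Dvd.intro q h)
  have hp2 := hp.two_le
  have hq2 := hq.two_le
  interval_cases p <;> omega

namespace HasPathPrimeGraph

variable {G H : Type*} [Group G] [Group H]

theorem verts_eq [Finite G] (h : HasPathPrimeGraph G) : (primeGraph G).verts = {2, 3, 5, 7} := by
  ext p
  have hdvd {g : G} {m : ℕ} (hg : orderOf g = m) {r : ℕ} (hr : r ∣ m) : r ∣ Nat.card G :=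
    (hr.trans hg.symm.dvd).trans (orderOf_dvd_natCard g)
  constructor
  · rintro ⟨hp, hc⟩
    have : Fact p.Prime := ⟨hp⟩
    obtain ⟨g, hg⟩ := exists_prime_orderOf_dvd_card' p hc
    exact hg ▸ h.order_prime g (hg ▸ hp)
  · obtain ⟨a, ha⟩ := h.six
    obtain ⟨b, hb⟩ := h.seven
    obtain ⟨c, hc⟩ := h.ten
    rintro (rfl | rfl | rfl | rfl)
    · exact ⟨by norm_num, hdvd ha (by norm_num)⟩
    · exact ⟨by norm_num, hdvd ha (by norm_num)⟩
    · exact ⟨by norm_num, hdvd hc (by norm_num)⟩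
    · exact ⟨by norm_num, hdvd hb (by norm_num)⟩

theorem adj_iff (h : HasPathPrimeGraph G) {p q : ℕ} : (primeGraph G).Adj p q ↔
    p = 2 ∧ q = 3 ∨ p = 3 ∧ q = 2 ∨ p = 2 ∧ q = 5 ∨ p = 5 ∧ q = 2 := by
  constructor
  · rintro ⟨hp, hq, hne, g, hg⟩
    exact prime_pair_of_mul_eq hp hq (h.order_mul g p q hp hq hne hg)
  · obtain ⟨a, ha⟩ := h.six
    obtain ⟨c, hc⟩ := h.ten
    rintro (⟨rfl, rfl⟩ | ⟨rfl, rfl⟩ | ⟨rfl, rfl⟩ | ⟨rfl, rfl⟩)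
    · exact ⟨by norm_num, by norm_num, by norm_num, a, ha⟩
    · exact ⟨by norm_num, by norm_num, by norm_num, a, ha⟩
    · exact ⟨by norm_num, by norm_num, by norm_num, c, hc⟩
    · exact ⟨by norm_num, by norm_num, by norm_num, c, hc⟩

theorem edgeSet_eq (h : HasPathPrimeGraph G) : (primeGraph G).edgeSet = {s(2, 3), s(2, 5)} := by
  ext e
  induction e using Sym2.ind with
  | _ p q =>
    rw [SimpleGraph.Subgraph.mem_edgeSet, h.adj_iff]
    simp only [Set.mem_insert_iff, Set.mem_singleton_iff, Sym2.eq_iff]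
    tauto

theorem primeGraph_eq [Finite G] [Finite H] (hG : HasPathPrimeGraph G)
    (hH : HasPathPrimeGraph H) : primeGraph G = primeGraph H := by
  refine SimpleGraph.Subgraph.ext (hG.verts_eq.trans hH.verts_eq.symm) ?_
  ext p q
  rw [hG.adj_iff, hH.adj_iff]

end HasPathPrimeGraph

theorem orderOf_eq_of_prime_factors {G : Type*} [Group G] {g : G} {k : ℕ} (hk : 0 < k)
    (h : g ^ k = 1) (h' : ∀ r ∈ k.primeFactors, g ^ (k / r) ≠ 1) : orderOf g = k :=
  orderOf_eq_of_pow_and_pow_div_prime hk h fun r hr hrk =>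
    h' r (Nat.mem_primeFactors.2 ⟨hr, hrk, hk.ne'⟩)

end PrimeGraphs

/-! ### Prime graphs of the extensions of degree two. -/

section DotTwo

open Matrix

variable {n p : ℕ} [Fact p.Prime]

theorem conj_injective_of_simple {S : Type*} [Group S] [IsSimpleGroup S]
    (h : ¬ ∀ a b : S, a * b = b * a) : Function.Injective (MulAut.conj : S →* MulAut S) := by
  rw [← MonoidHom.ker_eq_bot_iff]
  refine (IsSimpleGroup.eq_bot_or_eq_top_of_normal _ inferInstance).resolve_right fun ht => ?_
  refine h fun a b => ?_
  have : a ∈ (MulAut.conj : S →* MulAut S).ker := ht ▸ Subgroup.mem_top a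
  have := DFunLike.congr_fun (MonoidHom.mem_ker.1 this) b
  rw [MulAut.conj_apply, MulAut.one_apply, mul_inv_eq_iff_eq_mul] at this
  exact this

variable (n p) in
/-- Facts on the simple group `U_n(p)` that control the prime graphs of its extensions by
semilinear automorphisms. -/
structure SimpleUnitaryFacts : Prop where
  simple : IsSimpleGroup (PSU n p)
  not_comm : ¬ ∀ a b : PSU n p, a * b = b * a
  order_prime : ∀ g : PSU n p, (orderOf g).Prime → orderOf g ∈ ({2, 3, 5, 7} : Set ℕ)
  order_mul : ∀ (g : PSU n p) (p q : ℕ), p.Prime → q.Prime → p ≠ q → orderOf g = p * q →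
    p * q = 6 ∨ p * q = 10
  semilinear : ∀ g : PSU n p, orderOf g = 7 → ∀ E, semilinearAut n p E g ≠ g
  six : ∃ g : PSU n p, orderOf g = 6
  seven : ∃ g : PSU n p, orderOf g = 7

namespace SimpleUnitaryFacts

theorem conj_injective (h : SimpleUnitaryFacts n p) :
    Function.Injective (MulAut.conj : PSU n p →* MulAut (PSU n p)) :=
  have := h.simple
  conj_injective_of_simple h.not_comm

theorem orderOf_conj (h : SimpleUnitaryFacts n p) (x : PSU n p) :
    orderOf (MulAut.conj x) = orderOf x :=
  orderOf_injective _ h.conj_injective x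

theorem semilinearAut_ne_one (h : SimpleUnitaryFacts n p) (E : GU n p) :
    semilinearAut n p E ≠ 1 := fun h0 => by
  obtain ⟨g, hg⟩ := h.seven
  exact h.semilinear g hg E (by rw [h0, MulAut.one_apply])

/-- If τ_E were conjugation by X, then τ of X⁻¹E would be trivial and would fix elements of order 7.
-/
theorem semilinearAut_not_mem (h : SimpleUnitaryFacts n p) (E : GU n p) :
    semilinearAut n p E ∉ (MulAut.conj : PSU n p →* MulAut (PSU n p)).range := by
  rintro ⟨x, hx⟩
  obtain ⟨X, rfl⟩ := toPSU_surjective x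
  refine h.semilinearAut_ne_one (SUtoGU X⁻¹ * E) ?_
  rw [← conj_mul_semilinearAut, ← hx, map_inv, map_inv, inv_mul_cancel]

theorem relIndex_eq_two (h : SimpleUnitaryFacts n p) (D : GU n p) :
    (MulAut.conj : PSU n p →* MulAut (PSU n p)).range.relIndex (PSUDotTwo n p D) = 2 :=
  relIndex_sup_zpowers_eq_two (semilinearAut_sq_mem_range_conj D) (h.semilinearAut_not_mem D)

theorem isAlmostSimpleOver_self (h : SimpleUnitaryFacts n p) :
    IsAlmostSimpleOver (PSU n p) (PSU n p) :=
  ⟨h.simple, h.not_comm, MulAut.conj, h.conj_injective, le_rfl⟩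

theorem isAlmostSimpleOver_dotTwo (h : SimpleUnitaryFacts n p) (D : GU n p) :
    IsAlmostSimpleOver (PSUDotTwo n p D) (PSU n p) :=
  ⟨h.simple, h.not_comm, (PSUDotTwo n p D).subtype, Subtype.val_injective, by
    rw [Subgroup.range_subtype]
    exact le_sup_left⟩

theorem hasPathPrimeGraph_self (h : SimpleUnitaryFacts n p) (hten : ∃ g : PSU n p, orderOf g = 10) :
    HasPathPrimeGraph (PSU n p) :=
  ⟨h.order_prime, h.order_mul, h.six, h.seven, hten⟩

/-- The square of τ_E is conjugation by some x. Since τ_E commutes with its own square, it fixes x,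
which excludes order 7. -/
theorem orderOf_sq_ne_seven (h : SimpleUnitaryFacts n p) (E : GU n p) :
    orderOf (semilinearAut n p E ^ 2) ≠ 7 := by
  obtain ⟨x, hx⟩ := semilinearAut_sq_mem_range_conj E
  rw [sq, ← hx, h.orderOf_conj]
  intro h7
  refine h.semilinear x h7 E (h.conj_injective ?_)
  have h₁ := semilinearAut_mul_conj E x
  rw [hx, ← mul_assoc] at h₁
  rw [hx, mul_right_cancel h₁]

theorem orderOf_sq_semilinearAut_mem (h : SimpleUnitaryFacts n p) (E : GU n p)
    (hp : (orderOf (semilinearAut n p E ^ 2)).Prime) :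
    orderOf (semilinearAut n p E ^ 2) ∈ ({2, 3, 5} : Set ℕ) := by
  have h7 := h.orderOf_sq_ne_seven E
  obtain ⟨x, hx⟩ := semilinearAut_sq_mem_range_conj E
  rw [sq, ← hx, h.orderOf_conj] at hp h7 ⊢
  have := h.order_prime x hp
  simp only [Set.mem_insert_iff, Set.mem_singleton_iff] at this ⊢
  tauto

/-- An outer element of odd order has the same order as its inner square; one of order 2q with q odd
has a square of order q, which is 3 or 5. So only order 10 has to be supplied. -/
theorem hasPathPrimeGraph_dotTwo (h : SimpleUnitaryFacts n p) (D : GU n p)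
    (hten : ∃ g ∈ PSUDotTwo n p D, orderOf g = 10) : HasPathPrimeGraph (PSUDotTwo n p D) := by
  have lift {k : ℕ} (hk : ∃ g : PSU n p, orderOf g = k) :
      ∃ g : PSUDotTwo n p D, orderOf g = k := by
    obtain ⟨g, hg⟩ := hk
    exact ⟨⟨MulAut.conj g, conj_mem_PSUDotTwo D g⟩, by
      rw [← Subgroup.orderOf_coe, h.orderOf_conj, hg]⟩
  refine ⟨fun g hg => ?_, fun g p q hp hq hne hg => ?_, lift h.six, lift h.seven, ?_⟩
  · rw [← Subgroup.orderOf_coe] at hg ⊢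
    rcases mem_PSUDotTwo g.2 with ⟨x, hx⟩ | ⟨E, hE⟩
    · rw [← hx, h.orderOf_conj] at hg ⊢
      exact h.order_prime x hg
    · rw [hE] at hg ⊢
      rcases hg.eq_two_or_odd' with h2 | hodd
      · simp [h2]
      · have := (Nat.coprime_two_right.2 hodd).orderOf_pow
        have hmem := h.orderOf_sq_semilinearAut_mem E (this ▸ hg)
        rw [this] at hmem
        simp only [Set.mem_insert_iff, Set.mem_singleton_iff] at hmem ⊢
        tauto
  · rw [← Subgroup.orderOf_coe] at hg
    rcases mem_PSUDotTwo g.2 with ⟨x, hx⟩ | ⟨E, hE⟩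
    · rw [← hx, h.orderOf_conj] at hg
      exact h.order_mul x p q hp hq hne hg
    · rw [hE] at hg
      have even {p q : ℕ} (hq : q.Prime) (hne : p ≠ q) (hp2 : p = 2)
          (hg : orderOf (semilinearAut _ _ E) = p * q) : p * q = 6 ∨ p * q = 10 := by
        subst hp2
        have h2 : orderOf (semilinearAut _ _ E ^ 2) = q := by
          rw [orderOf_pow_of_dvd two_ne_zero ⟨q, hg⟩, hg, Nat.mul_div_cancel_left _ two_pos]
        have hmem := h.orderOf_sq_semilinearAut_mem E (h2.symm ▸ hq)
        rw [h2] at hmem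
        simp only [Set.mem_insert_iff, Set.mem_singleton_iff] at hmem
        omega
      rcases hp.eq_two_or_odd' with hp2 | hpo
      · exact even hq hne hp2 hg
      rcases hq.eq_two_or_odd' with hq2 | hqo
      · rw [mul_comm]
        exact even hp hne.symm hq2 (by rw [hg, mul_comm])
      have hodd : (orderOf (semilinearAut _ _ E)).Coprime 2 :=
        Nat.coprime_two_right.2 (hg ▸ hpo.mul hqo)
      have := hodd.orderOf_pow
      obtain ⟨x, hx⟩ := semilinearAut_sq_mem_range_conj E
      rw [sq, ← hx, h.orderOf_conj, hg] at this
      exact h.order_mul x p q hp hq hne this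
  · obtain ⟨g, hg, h10⟩ := hten
    exact ⟨⟨g, hg⟩, by rw [← Subgroup.orderOf_coe, h10]⟩

end SimpleUnitaryFacts

end DotTwo

/-! ### Orders in U_3(5) and U_4(3), and explicit elements. -/

section ExplicitElements

open Matrix

variable {n p : ℕ} [Fact p.Prime]

theorem mem_center_SU_iff (hK : HasSurjectiveNorm (GaloisField p 2)) (hn : 2 ≤ n) {A : SU n p} :
    A ∈ Subgroup.center (SU n p) ↔ ∃ c : GaloisField p 2, A.1 = c • 1 := by
  obtain ⟨e, he⟩ := exists_isotropic hK (i := (⟨0, by omega⟩ : Fin n)) (j := ⟨1, by omega⟩)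
    (by simp)
  exact hK.mem_center_iff he

theorem toPSU_pow_eq_one_iff (hK : HasSurjectiveNorm (GaloisField p 2)) (hn : 2 ≤ n) {A : SU n p}
    {k : ℕ} : toPSU n p A ^ k = 1 ↔ ∃ c : GaloisField p 2, A.1 ^ k = c • 1 := by
  rw [← map_pow, QuotientGroup.mk'_apply, QuotientGroup.eq_one_iff, mem_center_SU_iff hK hn,
    SubmonoidClass.coe_pow]

variable {a : ZMod p} {φ : QuadField p a →+* GaloisField p 2}

theorem map_model_mem_unitaryGroup (hs : ∀ x, φ (star x) = star (φ x))
    {A : Matrix (Fin n) (Fin n) (QuadField p a)} (hA : A * star A = 1) :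
    A.map φ ∈ unitaryGroup (Fin n) (GaloisField p 2) := by
  rw [mem_unitaryGroup_iff]
  have : star (A.map φ) = (star A).map φ := by
    ext i j
    simp [star_apply, hs]
  rw [this, ← Matrix.map_mul, hA]
  simp

theorem map_model_mem_specialUnitaryGroup (hs : ∀ x, φ (star x) = star (φ x))
    {A : Matrix (Fin n) (Fin n) (QuadField p a)} (hA : A * star A = 1) (hdet : A.det = 1) :
    A.map φ ∈ specialUnitaryGroup (Fin n) (GaloisField p 2) := by
  refine mem_specialUnitaryGroup_iff.2 ⟨map_model_mem_unitaryGroup hs hA, ?_⟩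
  rw [← RingHom.mapMatrix_apply, ← RingHom.map_det, hdet, map_one]

theorem exists_map_model_eq_smul_iff {K : Type*} [CommRing K] {M : Type*} [CommRing M]
    {φ : M →+* K} (hφ : Function.Bijective φ) (A : Matrix (Fin n) (Fin n) M) (k : ℕ) :
    (∃ c : K, (A.map φ) ^ k = c • 1) ↔ ∃ c : M, A ^ k = c • 1 := by
  have hpow : (A.map φ) ^ k = (A ^ k).map φ := by
    rw [← RingHom.mapMatrix_apply, ← map_pow, RingHom.mapMatrix_apply]
  have hsmul (c : M) : (c • (1 : Matrix (Fin n) (Fin n) M)).map φ = φ c • 1 := by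
    ext i j
    simp [one_apply, apply_ite φ]
  constructor
  · rintro ⟨c, hc⟩
    obtain ⟨c, rfl⟩ := hφ.2 c
    rw [hpow, ← hsmul] at hc
    exact ⟨c, Matrix.map_injective hφ.1 hc⟩
  · rintro ⟨c, hc⟩
    exact ⟨φ c, by rw [hpow, hc, hsmul]⟩

theorem exists_orderOf_eq_of_model (hn : 2 ≤ n) (hK : HasSurjectiveNorm (GaloisField p 2))
    (hφ : Function.Bijective φ) (hs : ∀ x, φ (star x) = star (φ x))
    (A : Matrix (Fin n) (Fin n) (QuadField p a)) (hA : A * star A = 1) (hdet : A.det = 1)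
    {k : ℕ} (hk : 0 < k) (hAk : ∃ c : QuadField p a, A ^ k = c • 1)
    (hne : ∀ r ∈ k.primeFactors, ¬ ∃ c : QuadField p a, A ^ (k / r) = c • 1) :
    ∃ g : PSU n p, orderOf g = k := by
  refine ⟨toPSU n p ⟨A.map φ, map_model_mem_specialUnitaryGroup hs hA hdet⟩,
    orderOf_eq_of_prime_factors hk ?_ fun r hr => ?_⟩
  · exact (toPSU_pow_eq_one_iff hK hn).2 ((exists_map_model_eq_smul_iff hφ A k).2 hAk)
  · intro h
    exact hne r hr ((exists_map_model_eq_smul_iff hφ A _).1 ((toPSU_pow_eq_one_iff hK hn).1 h))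

theorem PSU_three_five_pow (g : PSU 3 5) :
    (∃ k ∈ [6, 8, 10], g ^ k = 1) ∨ g ^ 7 = 1 ∧ ∀ E, semilinearAut 3 5 E g ≠ g := by
  have hK := hasSurjectiveNorm_five
  obtain ⟨A, rfl⟩ := toPSU_surjective g
  refine (SU_three_five_pow A).imp ?_ ?_
  · rintro ⟨k, hk, h⟩
    exact ⟨k, hk, (toPSU_pow_eq_one_iff hK (by norm_num)).2 h⟩
  · rintro ⟨h, h'⟩
    refine ⟨(toPSU_pow_eq_one_iff hK (by norm_num)).2 h, fun E hE => ?_⟩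
    obtain ⟨z, hz, hcoeff⟩ := star_charpoly_coeff_of_fixed
      (fun A hA => (mem_center_SU_iff hK (by norm_num)).1 hA) hE
    exact h' z hz (by simpa using hcoeff 1 (by norm_num))

theorem PSU_four_three_pow (g : PSU 4 3) :
    (∃ k ∈ [72, 5], g ^ k = 1) ∨ g ^ 7 = 1 ∧ ∀ E, semilinearAut 4 3 E g ≠ g := by
  have hK := hasSurjectiveNorm_three
  obtain ⟨A, rfl⟩ := toPSU_surjective g
  refine (SU_four_three_pow A).imp ?_ ?_
  · rintro ⟨k, hk, h⟩
    exact ⟨k, hk, (toPSU_pow_eq_one_iff hK (by norm_num)).2 h⟩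
  · rintro ⟨h, h'⟩
    refine ⟨(toPSU_pow_eq_one_iff hK (by norm_num)).2 h, fun E hE => ?_⟩
    obtain ⟨z, hz, hcoeff⟩ := star_charpoly_coeff_of_fixed
      (fun A hA => (mem_center_SU_iff hK (by norm_num)).1 hA) hE
    exact h' z hz (by simpa using hcoeff 1 (by norm_num)) (by simpa using hcoeff 2 (by norm_num))

theorem prime_mem_of_dvd_mem {r : ℕ} (hr : r.Prime) {L : List ℕ}
    (hL : ∀ k ∈ L, k ≠ 0 ∧ k.primeFactors ⊆ {2, 3, 5, 7}) (h : ∃ k ∈ L, r ∣ k) :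
    r ∈ ({2, 3, 5, 7} : Set ℕ) := by
  obtain ⟨k, hk, hrk⟩ := h
  have := (hL k hk).2 (Nat.mem_primeFactors.2 ⟨hr, hrk, (hL k hk).1⟩)
  simpa using this

theorem prime_mul_mem_of_dvd_mem {p q : ℕ} (hp : p.Prime) (hq : q.Prime) (hne : p ≠ q)
    {L : List ℕ} (hL : ∀ k ∈ L, k ≠ 0 ∧ ∀ p ∈ k.primeFactors, ∀ q ∈ k.primeFactors, p ≠ q →
      p * q = 6 ∨ p * q = 10) (h : ∃ k ∈ L, p * q ∣ k) : p * q = 6 ∨ p * q = 10 := by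
  obtain ⟨k, hk, hpq⟩ := h
  obtain ⟨h0, h⟩ := hL k hk
  exact h p (Nat.mem_primeFactors.2 ⟨hp, (Dvd.intro q rfl).trans hpq, h0⟩) q
    (Nat.mem_primeFactors.2 ⟨hq, (Dvd.intro_left p rfl).trans hpq, h0⟩) hne

theorem simpleUnitaryFacts_three_five : SimpleUnitaryFacts 3 5 := by
  have hK := hasSurjectiveNorm_five
  obtain ⟨φ, hφ, hs⟩ := exists_quadField_hom_five
  obtain ⟨e, he⟩ := exists_isotropic hK (show (0 : Fin 3) ≠ 1 by decide)
  have hdvd (g : PSU 3 5) : ∃ k ∈ [6, 8, 10, 7], orderOf g ∣ k := by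
    rcases PSU_three_five_pow g with ⟨k, hk, h⟩ | ⟨h, -⟩
    · refine ⟨k, ?_, orderOf_dvd_of_pow_eq_one h⟩
      simp only [List.mem_cons] at hk ⊢
      tauto
    · exact ⟨7, by simp, orderOf_dvd_of_pow_eq_one h⟩
  refine ⟨hK.isSimpleGroup_quotient_center (by simp) siegelSubgroup_three_five he,
    hK.not_commutative_quotient_center (by simp) siegelSubgroup_three_five he,
    fun g hg => prime_mem_of_dvd_mem hg (by decide +kernel) (hdvd g),
    fun g p q hp hq hne hg =>
      prime_mul_mem_of_dvd_mem hp hq hne (by decide +kernel) (hg ▸ hdvd g),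
    fun g hg => ?_, ?_, ?_⟩
  · refine ((PSU_three_five_pow g).resolve_left ?_).2
    rintro ⟨k, hk, h⟩
    have := orderOf_dvd_of_pow_eq_one h
    rw [hg] at this
    clear h
    revert this
    revert k
    decide
  -- The entry 3 + 2ω, with ω² = 2, generates the norm-one group of order 6, and 3 − 2ω is its
  -- inverse.
  · exact exists_orderOf_eq_of_model (by norm_num) hK hφ hs
      !![1, 0, 0; 0, ⟨3, 2⟩, 0; 0, 0, ⟨3, -2⟩] (by decide +kernel) (by decide +kernel)
      (by norm_num) (by decide +kernel) (by decide +kernel)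
  · exact exists_orderOf_eq_of_model (by norm_num) hK hφ hs
      !![⟨0, 0⟩, ⟨3, 3⟩, ⟨0, 0⟩; ⟨3, 1⟩, ⟨0, 0⟩, ⟨3, 0⟩; ⟨4, 1⟩, ⟨0, 0⟩, ⟨0, 2⟩]
      (by decide +kernel) (by decide +kernel) (by norm_num) (by decide +kernel) (by decide +kernel)

theorem exists_orderOf_eq_ten_three_five : ∃ g : PSU 3 5, orderOf g = 10 := by
  obtain ⟨φ, hφ, hs⟩ := exists_quadField_hom_five
  -- The upper block is −u with u unipotent (trace 2, determinant 1) of order 5.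
  exact exists_orderOf_eq_of_model (by norm_num) hasSurjectiveNorm_five hφ hs
    !![-⟨1, 1⟩, -⟨3, 1⟩, 0; -⟨2, 1⟩, -⟨1, 4⟩, 0; 0, 0, 1]
    (by decide +kernel) (by decide +kernel) (by norm_num) (by decide +kernel) (by decide +kernel)

theorem simpleUnitaryFacts_four_three : SimpleUnitaryFacts 4 3 := by
  have hK := hasSurjectiveNorm_three
  obtain ⟨φ, hφ, hs⟩ := exists_quadField_hom_three
  obtain ⟨e, he⟩ := exists_isotropic hK (show (0 : Fin 4) ≠ 1 by decide)
  have hdvd (g : PSU 4 3) : ∃ k ∈ [72, 5, 7], orderOf g ∣ k := by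
    rcases PSU_four_three_pow g with ⟨k, hk, h⟩ | ⟨h, -⟩
    · refine ⟨k, ?_, orderOf_dvd_of_pow_eq_one h⟩
      simp only [List.mem_cons] at hk ⊢
      tauto
    · exact ⟨7, by simp, orderOf_dvd_of_pow_eq_one h⟩
  refine ⟨hK.isSimpleGroup_quotient_center (by simp) siegelSubgroup_four_three he,
    hK.not_commutative_quotient_center (by simp) siegelSubgroup_four_three he,
    fun g hg => prime_mem_of_dvd_mem hg (by decide +kernel) (hdvd g),
    fun g p q hp hq hne hg =>
      prime_mul_mem_of_dvd_mem hp hq hne (by decide +kernel) (hg ▸ hdvd g),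
    fun g hg => ?_, ?_, ?_⟩
  · refine ((PSU_four_three_pow g).resolve_left ?_).2
    rintro ⟨k, hk, h⟩
    have := orderOf_dvd_of_pow_eq_one h
    rw [hg] at this
    clear h
    revert this
    revert k
    decide
  -- A unipotent block of order 3 (trace 2, determinant 1) next to the scalar block −1.
  · exact exists_orderOf_eq_of_model (by norm_num) hK hφ hs
      !![⟨1, 2⟩, ⟨2, 1⟩, 0, 0; ⟨1, 1⟩, ⟨1, 1⟩, 0, 0; 0, 0, -1, 0; 0, 0, 0, -1]
      (by decide +kernel) (by decide +kernel) (by norm_num) (by decide +kernel) (by decide +kernel)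
  · exact exists_orderOf_eq_of_model (by norm_num) hK hφ hs
      !![⟨0, 0⟩, ⟨0, 0⟩, ⟨0, 0⟩, ⟨0, 1⟩; ⟨0, 0⟩, ⟨2, 2⟩, ⟨2, 1⟩, ⟨0, 0⟩;
        ⟨1, 1⟩, ⟨2, 0⟩, ⟨0, 2⟩, ⟨0, 0⟩; ⟨2, 1⟩, ⟨0, 1⟩, ⟨2, 0⟩, ⟨0, 0⟩]
      (by decide +kernel) (by decide +kernel) (by norm_num) (by decide +kernel) (by decide +kernel)

/-- A semilinear involution together with an element of order five that it centralizes. -/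
theorem exists_orderOf_eq_ten_of_model {a : ZMod 3} {φ : QuadField 3 a →+* GaloisField 3 2}
    (hφ : Function.Bijective φ) (hs : ∀ x, φ (star x) = star (φ x)) (D : GU 4 3)
    (E A : Matrix (Fin 4) (Fin 4) (QuadField 3 a)) (hE : E * star E = 1) (hA : A * star A = 1)
    (hdet : A.det = 1) (hED : φ E.det = D.1.det) (hsq : ∃ c : QuadField 3 a, E * E.map star = c • 1)
    (hcomm : E * A.map star = A * E) (hA5 : A ^ 5 = 1) (hA1 : ¬ ∃ c : QuadField 3 a, A ^ 1 = c • 1) :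
    ∃ g ∈ PSUDotTwo 4 3 D, orderOf g = 10 := by
  have hK := hasSurjectiveNorm_three
  have hF := simpleUnitaryFacts_four_three
  let E' : GU 4 3 := ⟨E.map φ, map_model_mem_unitaryGroup hs hE⟩
  let A' : SU 4 3 := ⟨A.map φ, map_model_mem_specialUnitaryGroup hs hA hdet⟩
  have hstar (B : Matrix (Fin 4) (Fin 4) (QuadField 3 a)) :
      (B.map φ).map (starRingEnd (GaloisField 3 2)) = (B.map star).map φ := by
    ext i j
    simp [hs, starRingEnd_apply]
  have hfix : semilinearAut 4 3 E' (toPSU 4 3 A') = toPSU 4 3 A' := by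
    rw [semilinearAut_toPSU]
    congr 1
    refine Subtype.ext ?_
    rw [conjSU_frobSU_val]
    change E.map φ * (A.map φ).map _ * (E'⁻¹).1 = A.map φ
    rw [hstar, ← Matrix.map_mul, hcomm, Matrix.map_mul, mul_assoc]
    exact (congrArg _ (GU_mul_inv_val E')).trans (mul_one _)
  have hinvol : semilinearAut 4 3 E' ^ 2 = 1 := by
    obtain ⟨c, hc⟩ := hsq
    ext x
    obtain ⟨B, rfl⟩ := toPSU_surjective x
    rw [sq, MulAut.mul_apply, semilinearAut_toPSU, semilinearAut_toPSU, MulAut.one_apply]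
    congr 1
    refine Subtype.ext ?_
    rw [conjSU_frobSU_val, conjSU_frobSU_val, Matrix.map_mul, Matrix.map_mul, map_map_star]
    have h₁ : E'.1 * E'.1.map (starRingEnd (GaloisField 3 2)) = φ c • 1 := by
      change E.map φ * (E.map φ).map _ = _
      rw [hstar, ← Matrix.map_mul, hc]
      ext i j
      simp [one_apply, apply_ite φ]
    have h₂ : (E'⁻¹).1.map (starRingEnd (GaloisField 3 2)) * (E'⁻¹).1 =
        (star (E'.1 * E'.1.map (starRingEnd (GaloisField 3 2)))) := by
      rw [StarMul.star_mul]
      congr 1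
    have h₃ : φ c * star (φ c) = 1 := by
      have h₄ := mem_unitaryGroup_iff.1 (mul_mem E'.2 (UnitaryGroup.map_star E').2)
      have h₅ : E'.1 * (UnitaryGroup.map_star E').1 = φ c • 1 := h₁
      rw [h₅] at h₄
      have := congrFun (congrFun h₄ 0) 0
      simpa [star_apply, Matrix.mul_apply, one_apply, Fin.sum_univ_four] using this
    calc E'.1 * (E'.1.map _ * B.1 * (E'⁻¹).1.map _) * (E'⁻¹).1
        = (E'.1 * E'.1.map (starRingEnd (GaloisField 3 2))) * B.1 *
          ((E'⁻¹).1.map (starRingEnd (GaloisField 3 2)) * (E'⁻¹).1) := by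
            simp only [mul_assoc]
      _ = B.1 := by
        rw [h₂, h₁, star_smul, star_one, smul_one_mul, mul_smul_one, smul_smul, mul_comm, h₃,
          one_smul]
  have hord2 : orderOf (semilinearAut 4 3 E') = 2 :=
    orderOf_eq_prime hinvol (hF.semilinearAut_ne_one E')
  have hord5 : orderOf (MulAut.conj (toPSU 4 3 A')) = 5 := by
    rw [hF.orderOf_conj]
    have : Fact (Nat.Prime 5) := ⟨by norm_num⟩
    refine orderOf_eq_prime ?_ fun h => hA1 ?_
    · refine (toPSU_pow_eq_one_iff hK (by norm_num)).2
        ((exists_map_model_eq_smul_iff hφ A 5).2 ⟨1, by rw [hA5, one_smul]⟩)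
    · exact (exists_map_model_eq_smul_iff hφ A 1).1
        ((toPSU_pow_eq_one_iff (A := A') hK (by norm_num)).1 (by rw [h, one_pow]))
  have hc : Commute (MulAut.conj (toPSU 4 3 A')) (semilinearAut 4 3 E') := by
    have := semilinearAut_mul_conj E' (toPSU 4 3 A')
    rw [hfix] at this
    exact this.symm
  refine ⟨MulAut.conj (toPSU 4 3 A') * semilinearAut 4 3 E', mul_mem (conj_mem_PSUDotTwo D _)
    (semilinearAut_mem_PSUDotTwo ?_), ?_⟩
  · change (E.map φ).det = _
    rw [← RingHom.mapMatrix_apply, ← RingHom.map_det, hED]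
  · rw [hc.orderOf_mul_eq_mul_orderOf_of_coprime (by rw [hord2, hord5]; norm_num), hord2, hord5]

theorem exists_orderOf_eq_ten_four_three_dotTwo (D : GU 4 3) :
    ∃ g ∈ PSUDotTwo 4 3 D, orderOf g = 10 := by
  obtain ⟨φ, hφ, hs⟩ := exists_quadField_hom_three
  obtain ⟨d, hd⟩ := hφ.2 D.1.det
  have hd1 : d * star d = 1 := hφ.1 (by
    rw [map_mul, hs, hd, map_one]
    exact (det_of_mem_unitary D.2).2)
  -- Only the determinant of D matters, and it has norm one: it is a fourth root of unity in F_9.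
  -- For unitary A, the relation E·A^(p) = A·E says that A preserves the bilinear form with matrix
  -- E. That form is alternating for determinants ±1 and symmetric for the other two.
  have hcases : ∀ d : QuadField 3 (-1), d * star d = 1 →
      d = 1 ∨ d = -1 ∨ d = ⟨0, 1⟩ ∨ d = ⟨0, 2⟩ := by decide +kernel
  rcases hcases d hd1 with rfl | rfl | rfl | rfl
  · exact exists_orderOf_eq_ten_of_model hφ hs D
      !![0, 1, 0, 0; -1, 0, 0, 0; 0, 0, 0, 1; 0, 0, -1, 0]
      !![⟨0, 0⟩, ⟨2, 2⟩, ⟨0, 0⟩, ⟨2, 1⟩; ⟨1, 2⟩, ⟨0, 0⟩, ⟨1, 1⟩, ⟨0, 0⟩;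
        ⟨2, 1⟩, ⟨0, 0⟩, ⟨1, 1⟩, ⟨0, 0⟩; ⟨0, 0⟩, ⟨2, 2⟩, ⟨0, 0⟩, ⟨1, 2⟩]
      (by decide +kernel) (by decide +kernel) (by decide +kernel)
      (by rw [← hd]; exact congrArg φ (by decide +kernel)) (by decide +kernel) (by decide +kernel)
      (by decide +kernel) (by decide +kernel)
  · exact exists_orderOf_eq_ten_of_model hφ hs D
      !![0, 1, 0, 0; -1, 0, 0, 0; 0, 0, 0, ⟨0, 1⟩; 0, 0, -⟨0, 1⟩, 0]
      !![⟨0, 0⟩, ⟨2, 2⟩, ⟨2, 1⟩, ⟨0, 0⟩; ⟨1, 2⟩, ⟨0, 0⟩, ⟨0, 0⟩, ⟨2, 1⟩;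
        ⟨0, 0⟩, ⟨1, 2⟩, ⟨1, 1⟩, ⟨0, 0⟩; ⟨1, 2⟩, ⟨0, 0⟩, ⟨0, 0⟩, ⟨1, 2⟩]
      (by decide +kernel) (by decide +kernel) (by decide +kernel)
      (by rw [← hd]; exact congrArg φ (by decide +kernel)) (by decide +kernel) (by decide +kernel)
      (by decide +kernel) (by decide +kernel)
  · exact exists_orderOf_eq_ten_of_model hφ hs D
      !![1, 0, 0, 0; 0, 1, 0, 0; 0, 0, 1, 0; 0, 0, 0, ⟨0, 1⟩]
      !![⟨0, 0⟩, ⟨2, 0⟩, ⟨2, 0⟩, ⟨2, 1⟩; ⟨0, 0⟩, ⟨2, 0⟩, ⟨2, 0⟩, ⟨1, 2⟩;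
        ⟨2, 0⟩, ⟨0, 0⟩, ⟨0, 0⟩, ⟨0, 0⟩; ⟨0, 0⟩, ⟨2, 2⟩, ⟨1, 1⟩, ⟨0, 0⟩]
      (by decide +kernel) (by decide +kernel) (by decide +kernel)
      (by rw [← hd]; exact congrArg φ (by decide +kernel)) (by decide +kernel) (by decide +kernel)
      (by decide +kernel) (by decide +kernel)
  · exact exists_orderOf_eq_ten_of_model hφ hs D
      !![1, 0, 0, 0; 0, 1, 0, 0; 0, 0, 1, 0; 0, 0, 0, ⟨0, 2⟩]
      !![⟨0, 0⟩, ⟨0, 0⟩, ⟨2, 0⟩, ⟨0, 0⟩; ⟨1, 0⟩, ⟨2, 0⟩, ⟨0, 0⟩, ⟨1, 1⟩;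
        ⟨2, 0⟩, ⟨1, 0⟩, ⟨0, 0⟩, ⟨1, 1⟩; ⟨2, 1⟩, ⟨2, 1⟩, ⟨0, 0⟩, ⟨0, 0⟩]
      (by decide +kernel) (by decide +kernel) (by decide +kernel)
      (by rw [← hd]; exact congrArg φ (by decide +kernel)) (by decide +kernel) (by decide +kernel)
      (by decide +kernel) (by decide +kernel)

end ExplicitElements

/-! ### Element orders in PGL(2,49). -/

section ProjectiveLinear

open Matrix

theorem PGL_mk_pow_eq_one_iff {K : Type*} [Field K] {n : ℕ} (A : GL (Fin n) K) (k : ℕ) :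
    ProjGenLinGroup.mk A ^ k = 1 ↔ ∃ c : K, A.1 ^ k = c • 1 := by
  rw [← map_pow, ProjGenLinGroup.mk_eq_one, GeneralLinearGroup.mem_center_iff_val_mem_range_scalar,
    Units.val_pow_eq_pow_val]
  simp only [Set.mem_range, scalar_apply, smul_one_eq_diagonal, eq_comm]

/-- The coefficients `(a, b)` of the remainder `a X + b` of `X ^ k` modulo `X ^ 2 - X + d`. -/
def quadraticPow {R : Type*} [CommRing R] (d : R) (k : ℕ) : R × R :=
  (fun x => (x.1 + x.2, -(x.1 * d)))^[k] (0, 1)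

theorem pow_eq_quadraticPow {R : Type*} [CommRing R] {A : Matrix (Fin 2) (Fin 2) R} {d : R}
    (hA : A * A = A - d • 1) (k : ℕ) :
    A ^ k = (quadraticPow d k).1 • A + (quadraticPow d k).2 • 1 := by
  induction k with
  | zero => simp [quadraticPow]
  | succ k ih =>
    have hsucc : quadraticPow d (k + 1) =
        ((quadraticPow d k).1 + (quadraticPow d k).2, -((quadraticPow d k).1 * d)) :=
      Function.iterate_succ_apply' _ k _
    rw [pow_succ, ih, add_mul, smul_mul_assoc, hA, hsucc, smul_sub, smul_one_mul, smul_smul,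
      add_smul, neg_smul]
    abel

theorem mul_self_eq_of_fin_two {R : Type*} [CommRing R] (A : Matrix (Fin 2) (Fin 2) R) :
    A * A = A.trace • A - A.det • 1 := by
  ext i j
  fin_cases i <;> fin_cases j <;>
    simp [Matrix.mul_apply, Fin.sum_univ_two, trace_fin_two, det_fin_two] <;> ring

/-- Trace zero makes the square scalar. Otherwise scale to trace one, so that only the determinant
remains to be enumerated. The exponents reflect the split tori (48), the nonsplit tori (50) and the
unipotents (7). -/
theorem GL_two_forty_nine_pow (A : GL (Fin 2) (GaloisField 7 2)) :
    ∃ k ∈ [48, 50, 7], ∃ c : GaloisField 7 2, A.1 ^ k = c • 1 := by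
  have hsq := mul_self_eq_of_fin_two A.1
  have hdet : A.1.det ≠ 0 := (A.1.isUnit_iff_isUnit_det.1 A.isUnit).ne_zero
  by_cases ht : A.1.trace = 0
  · refine ⟨48, by simp, (-A.1.det) ^ 24, ?_⟩
    rw [ht, zero_smul, zero_sub, ← neg_smul] at hsq
    rw [show 48 = 2 * 24 by norm_num, pow_mul, sq, hsq, smul_pow, one_pow]
  obtain ⟨φ, hφ, -⟩ := exists_quadField_hom_seven
  obtain ⟨B, hB⟩ : ∃ B : Matrix (Fin 2) (Fin 2) (QuadField 7 (-1)),
      B.map φ = A.1.trace⁻¹ • A.1 := by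
    choose ψ hψ using hφ.2
    exact ⟨(A.1.trace⁻¹ • A.1).map ψ, by ext i j; simp [hψ]⟩
  have htrB : B.trace = 1 := hφ.1 (by
    have : φ B.trace = (B.map φ).trace := by simp [trace]
    rw [this, hB, trace_smul, smul_eq_mul, inv_mul_cancel₀ ht, map_one])
  have hdetB : B.det ≠ 0 := fun h => by
    have h₁ : (B.map φ).det = 0 := by
      rw [← RingHom.mapMatrix_apply, ← RingHom.map_det, h, map_zero]
    rw [hB, det_smul] at h₁
    exact mul_ne_zero (pow_ne_zero _ (inv_ne_zero ht)) hdet h₁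
  have key : ∀ d : QuadField 7 (-1), d ≠ 0 → ∃ k ∈ [48, 50, 7], (quadraticPow d k).1 = 0 := by
    decide +kernel
  obtain ⟨k, hk, hzero⟩ := key _ hdetB
  have hBk := pow_eq_quadraticPow (by simpa [htrB] using mul_self_eq_of_fin_two B) k
  rw [hzero, zero_smul, zero_add] at hBk
  obtain ⟨c, hc⟩ := (exists_map_model_eq_smul_iff hφ B k).2 ⟨_, hBk⟩
  refine ⟨k, hk, A.1.trace ^ k * c, ?_⟩
  rw [hB, smul_pow, inv_pow, inv_smul_eq_iff₀ (pow_ne_zero k ht)] at hc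
  rw [hc, smul_smul]

theorem exists_orderOf_eq_PGL_two_forty_nine (A : Matrix (Fin 2) (Fin 2) (QuadField 7 (-1)))
    (hA : A.det ≠ 0) {k : ℕ} (hk : 0 < k) (hAk : ∃ c : QuadField 7 (-1), A ^ k = c • 1)
    (hne : ∀ r ∈ k.primeFactors, ¬ ∃ c : QuadField 7 (-1), A ^ (k / r) = c • 1) :
    ∃ g : PGL2F49, orderOf g = k := by
  obtain ⟨φ, hφ, -⟩ := exists_quadField_hom_seven
  have hdet : (A.map φ).det ≠ 0 := by
    rw [← RingHom.mapMatrix_apply, ← RingHom.map_det]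
    exact (map_ne_zero_iff φ hφ.1).2 hA
  refine ⟨ProjGenLinGroup.mk (GeneralLinearGroup.mkOfDetNeZero _ hdet),
    orderOf_eq_of_prime_factors hk ?_ fun r hr h => ?_⟩
  · exact (PGL_mk_pow_eq_one_iff _ _).2 ((exists_map_model_eq_smul_iff hφ A k).2 hAk)
  · exact hne r hr ((exists_map_model_eq_smul_iff hφ A _).1 ((PGL_mk_pow_eq_one_iff _ _).1 h))

theorem hasPathPrimeGraph_PGL_two_forty_nine : HasPathPrimeGraph PGL2F49 := by
  have hdvd (g : PGL2F49) : ∃ k ∈ [48, 50, 7], orderOf g ∣ k := by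
    obtain ⟨A, rfl⟩ := ProjGenLinGroup.mk_surjective g
    obtain ⟨k, hk, h⟩ := GL_two_forty_nine_pow A
    exact ⟨k, hk, orderOf_dvd_of_pow_eq_one ((PGL_mk_pow_eq_one_iff A k).2 h)⟩
  refine ⟨fun g hg => prime_mem_of_dvd_mem hg (by decide +kernel) (hdvd g),
    fun g p q hp hq hne hg =>
      prime_mul_mem_of_dvd_mem hp hq hne (by decide +kernel) (hg ▸ hdvd g), ?_, ?_, ?_⟩
  -- Companion matrices of X² − X + d. For d = 5 the roots are 2 and −1, whose ratio has order 6; d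
  -- = 2 gives a double root, hence order 7; d = 4 + ω, with ω² = −1, gives order 10.
  · exact exists_orderOf_eq_PGL_two_forty_nine !![0, -5; 1, 1] (by decide +kernel) (by norm_num)
      (by decide +kernel) (by decide +kernel)
  · exact exists_orderOf_eq_PGL_two_forty_nine !![0, -2; 1, 1] (by decide +kernel) (by norm_num)
      (by decide +kernel) (by decide +kernel)
  · exact exists_orderOf_eq_PGL_two_forty_nine !![0, -⟨4, 1⟩; 1, 1] (by decide +kernel)
      (by norm_num) (by decide +kernel) (by decide +kernel)

instance finite_PGL2F49 : Finite PGL2F49 :=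
  Finite.of_surjective _ ProjGenLinGroup.mk_surjective

end ProjectiveLinear

/-! ### The symmetric group of degree seven. -/

section SymmetricGroup

open Equiv

/-- If σ moves x, some even permutation moves x but fixes σx, and σ cannot commute with it. -/
theorem conjNormal_alternatingGroup_injective :
    Function.Injective (MulAut.conjNormal : Perm (Fin 7) →* MulAut (alternatingGroup (Fin 7))) := by
  rw [injective_iff_map_eq_one]
  intro σ hσ
  by_contra hne
  obtain ⟨x, hx⟩ : ∃ x, σ x ≠ x := by
    by_contra! h
    exact hne (Equiv.ext h)
  have key : ∀ x y : Fin 7, y ≠ x →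
      ∃ τ : Fin 7 × Fin 7, (swap x τ.1 * swap x τ.2) x ≠ x ∧ (swap x τ.1 * swap x τ.2) y = y ∧
        Perm.sign (swap x τ.1 * swap x τ.2) = 1 := by decide +kernel
  obtain ⟨τ, h₁, h₂, h₃⟩ := key x (σ x) hx
  have h := congrArg Subtype.val
    (DFunLike.congr_fun hσ (⟨swap x τ.1 * swap x τ.2, h₃⟩ : alternatingGroup (Fin 7)))
  rw [MulAut.conjNormal_apply, MulAut.one_apply, mul_inv_eq_iff_eq_mul] at h
  have := congrArg (fun f : Perm (Fin 7) => f x) h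
  simp only [Perm.mul_apply] at this h₁ h₂
  rw [h₂] at this
  exact h₁ (σ.injective this)

theorem isAlmostSimpleOver_perm_seven :
    IsAlmostSimpleOver (Perm (Fin 7)) (alternatingGroup (Fin 7)) := by
  refine ⟨alternatingGroup.isSimpleGroup (by simp), fun h => ?_, MulAut.conjNormal,
    conjNormal_alternatingGroup_injective, ?_⟩
  · have := congrArg Subtype.val
      (h ⟨swap 0 1 * swap 0 2, Perm.mem_alternatingGroup.2 (by decide +kernel)⟩
        ⟨swap 0 1 * swap 0 3, Perm.mem_alternatingGroup.2 (by decide +kernel)⟩)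
    revert this
    decide +kernel
  · rintro _ ⟨a, rfl⟩
    exact ⟨a, rfl⟩

theorem exists_mem_dvd_of_prime_dvd_lcm {s : Multiset ℕ} {p : ℕ} (hp : p.Prime) (h : p ∣ s.lcm) :
    ∃ m ∈ s, p ∣ m := by
  induction s using Multiset.induction with
  | empty => exact absurd (Nat.dvd_one.1 (by simpa using h)) hp.ne_one
  | cons a s ih =>
    rw [Multiset.lcm_cons] at h
    rcases (hp.dvd_lcm).1 h with h | h
    · exact ⟨a, Multiset.mem_cons_self a s, h⟩
    · obtain ⟨m, hm, h⟩ := ih h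
      exact ⟨m, Multiset.mem_cons_of_mem hm, h⟩

/-- The primes divide cycle lengths. Different lengths occupy at least p + q points; a common length
is divisible by pq, and pq ≥ p + q. -/
theorem add_le_or_mul_le_of_mul_dvd_orderOf {σ : Perm (Fin 7)} {p q : ℕ} (hp : p.Prime)
    (hq : q.Prime) (hne : p ≠ q) (h : p * q ∣ orderOf σ) : p + q ≤ 7 := by
  rw [← Perm.lcm_cycleType] at h
  obtain ⟨m, hm, hpm⟩ := exists_mem_dvd_of_prime_dvd_lcm hp ((Dvd.intro q rfl).trans h)
  obtain ⟨l, hl, hql⟩ := exists_mem_dvd_of_prime_dvd_lcm hq ((Dvd.intro_left p rfl).trans h)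
  have hsum : σ.cycleType.sum ≤ 7 := by simpa using Perm.sum_cycleType_le σ
  have hpos {m : ℕ} (hm : m ∈ σ.cycleType) : 0 < m :=
    two_pos.trans_le (Perm.two_le_of_mem_cycleType hm)
  obtain ⟨t, ht⟩ := Multiset.exists_cons_of_mem hm
  rw [ht, Multiset.sum_cons] at hsum
  by_cases hml : l = m
  · subst hml
    have := Nat.le_of_dvd (hpos hm)
      (((Nat.coprime_primes hp hq).2 hne).mul_dvd_of_dvd_of_dvd hpm hql)
    have := Nat.add_le_mul hp.two_le hq.two_le
    omega
  · rw [ht] at hl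
    have h₁ := Multiset.le_sum_of_mem ((Multiset.mem_cons.1 hl).resolve_left hml)
    have h₂ := Nat.le_of_dvd (hpos hm) hpm
    have h₃ := Nat.le_of_dvd (hpos (ht ▸ hl)) hql
    omega

theorem hasPathPrimeGraph_perm_seven : HasPathPrimeGraph (Perm (Fin 7)) := by
  refine ⟨fun σ hσ => ?_, fun σ p q hp hq hne h => ?_, ?_, ?_, ?_⟩
  · have h := orderOf_dvd_natCard σ
    rw [Nat.card_perm, Nat.card_fin, hσ.dvd_factorial] at h
    generalize orderOf σ = r at hσ h
    interval_cases r <;> revert hσ <;> norm_num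
  · have := add_le_or_mul_le_of_mul_dvd_orderOf hp hq hne h.symm.dvd
    have hp7 : p ≤ 5 := by have := hq.two_le; omega
    have hq7 : q ≤ 5 := by have := hp.two_le; omega
    interval_cases p <;> interval_cases q <;> revert hp hq hne <;> norm_num <;> omega
  · exact ⟨swap 0 1 * (swap 2 3 * swap 2 4),
      orderOf_eq_of_prime_factors (by norm_num) (by decide +kernel) (by decide +kernel)⟩
  · exact ⟨finRotate 7,
      orderOf_eq_of_prime_factors (by norm_num) (by decide +kernel) (by decide +kernel)⟩
  · exact ⟨swap 0 1 * (swap 2 3 * swap 2 4 * swap 2 5 * swap 2 6),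
      orderOf_eq_of_prime_factors (by norm_num) (by decide +kernel) (by decide +kernel)⟩

end SymmetricGroup

instance finite_PSU (n p : ℕ) [Fact p.Prime] : Finite (PSU n p) :=
  Finite.of_surjective _ toPSU_surjective

instance finite_PSUDotTwo (n p : ℕ) [Fact p.Prime] (D : GU n p) : Finite (PSUDotTwo n p D) :=
  have : Finite (MulAut (PSU n p)) := DFunLike.finite _
  inferInstance

theorem lemma3p2 :
    -- the prime graph of `PGL(2, 49)`
    ((primeGraph PGL2F49).verts = {2, 3, 5, 7} ∧
      (primeGraph PGL2F49).edgeSet = {s(2, 3), s(2, 5)}) ∧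
    -- `S₇`
    (IsAlmostSimpleOver (Equiv.Perm (Fin 7)) (alternatingGroup (Fin 7)) ∧
      primeGraph (Equiv.Perm (Fin 7)) = primeGraph PGL2F49) ∧
    -- `U₄(3)·2`
    (∀ D : GU 4 3,
      (MulAut.conj : PSU 4 3 →* MulAut (PSU 4 3)).range.relIndex (PSUDotTwo 4 3 D) = 2 ∧
      IsAlmostSimpleOver (PSUDotTwo 4 3 D) (PSU 4 3) ∧
      primeGraph (PSUDotTwo 4 3 D) = primeGraph PGL2F49) ∧
    -- `U₃(5)`
    (IsAlmostSimpleOver (PSU 3 5) (PSU 3 5) ∧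
      primeGraph (PSU 3 5) = primeGraph PGL2F49) ∧
    -- `U₃(5)·2`
    (∀ D : GU 3 5,
      (MulAut.conj : PSU 3 5 →* MulAut (PSU 3 5)).range.relIndex (PSUDotTwo 3 5 D) = 2 ∧
      IsAlmostSimpleOver (PSUDotTwo 3 5 D) (PSU 3 5) ∧
      primeGraph (PSUDotTwo 3 5 D) = primeGraph PGL2F49) := by
  have hPGL := hasPathPrimeGraph_PGL_two_forty_nine
  have h₃ := simpleUnitaryFacts_three_five
  have h₄ := simpleUnitaryFacts_four_three
  obtain ⟨g, hg⟩ := exists_orderOf_eq_ten_three_five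
  refine ⟨⟨hPGL.verts_eq, hPGL.edgeSet_eq⟩,
    ⟨isAlmostSimpleOver_perm_seven, hasPathPrimeGraph_perm_seven.primeGraph_eq hPGL⟩,
    fun D => ⟨h₄.relIndex_eq_two D, h₄.isAlmostSimpleOver_dotTwo D,
      (h₄.hasPathPrimeGraph_dotTwo D (exists_orderOf_eq_ten_four_three_dotTwo D)).primeGraph_eq
        hPGL⟩,
    ⟨h₃.isAlmostSimpleOver_self, (h₃.hasPathPrimeGraph_self ⟨g, hg⟩).primeGraph_eq hPGL⟩,
    fun D => ⟨h₃.relIndex_eq_two D, h₃.isAlmostSimpleOver_dotTwo D, ?_⟩⟩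
  -- Unlike for U_4(3), the element of order 10 is inherited from the simple group.
  exact (h₃.hasPathPrimeGraph_dotTwo D ⟨MulAut.conj g, conj_mem_PSUDotTwo D g,
    (h₃.orderOf_conj g).trans hg⟩).primeGraph_eq hPGL
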